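/- Let $T>0$ and $p\ge 1$ be real numbers and let $d\ge 1$ be an integer with $d<6p$. For $t>0$ and $x,y\in\mathbb R^d$ let $$K_{t;x,y}=(2\pi)^{-d}\int_{\mathbb R^d} e^{-\frac t8(-2+|\xi|^2)^2}\cos(\langle \xi,x-y\rangle)\,d\xi$$ be the L-KS kernel (the fundamental solution of $\partial_t u=-\tfrac18(\Delta+2)^2u$). Write $|\cdot|_{2p}$ for the norm of $L^{2p}(\mathbb R^d;\mathbb R)$. For $\tau>0$ and $u_0\in L^{2p}(\mathbb R^d;\mathbb R)$, an L-KS solution on $[0,\tau]$ with data $u_0$ of the Kuramoto–Sivashinsky–Burgers equation $$\partial_t U=-\tfrac18(\Delta^2+4\Delta)U-\tfrac12\sum_{\ell=1}^d\partial_\ell U^2,\qquad U(0,\cdot)=u_0,$$ is a function $U\in C([0,\tau];L^{2p}(\mathbb R^d;\mathbb R))$ such that $U(0)=u_0$ and, for every $t\in(0,\tau]$ and almost every $x\in\mathbb R^d$, $$U(t,x)=\int_{\mathbb R^d}K_{t;x,y}u_0(y)\,dy+\tfrac12\int_0^t\!\!\int_{\mathbb R^d}K_{t-r;x,y}U(r,y)\,dy\,dr+\tfrac12\sum_{\ell=1}^d\int_0^t\!\!\int_{\mathbb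 R^d}\frac{\partial K_{t-r;x,y}}{\partial y_\ell}U^2(r,y)\,dy\,dr .$$ Then there is a function $M\mapsto C_{T,d,p}(M)\in(0,\infty)$, depending only on $T,d,p$, such that the following holds. Let $u_0^{(1)},u_0^{(2)}\in L^{2p}(\mathbb R^d;\mathbb R)$ and let $U^{(1)},U^{(2)}\in C([0,T];L^{2p}(\mathbb R^d;\mathbb R))$ be L-KS solutions on $[0,T]$ with data $u_0^{(1)},u_0^{(2)}$. Then for all $t\in[0,T]$ $$|U^{(1)}(t)-U^{(2)}(t)|_{2p}\le C_{T,d,p}(M)\,|u_0^{(1)}-u_0^{(2)}|_{2p},\qquad M=\max_{k=1,2}\ \sup_{0\le r\le T}|U^{(k)}(r)|_{2p}.$$ In particular the same holds for local solutions: for every $\tau\in(0,T]$, if $U^{(1)},U^{(2)}$ are L-KS solutions on $[0,\tau]$ with data $u_0^{(1)},u_0^{(2)}$, then the inequality holds for all $t\in[0,\tau]$ with the same function $C_{T,d,p}$ and with $M=\max_{k=1,2}\sup_{0\le r\le \tau}|U^{(k)}(r)|_{2p}$. -/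

import Mathlib

open MeasureTheory Set

noncomputable section

namespace KSB

/-- The Euclidean space `ℝ^d`. -/
abbrev Rd (d : ℕ) : Type := EuclideanSpace ℝ (Fin d)

/-- If `1 ≤ p` then `1 ≤ 2p`, so that `L^{2p}` is a normed space. -/
instance fact_one_le_two_mul (p : ℝ) [hp : Fact (1 ≤ p)] :
    Fact ((1 : ENNReal) ≤ ENNReal.ofReal (2 * p)) :=
  ⟨by
    rw [← ENNReal.ofReal_one]
    exact ENNReal.ofReal_le_ofReal (by linarith [hp.out])⟩

/-- The space `L^{2p}(ℝ^d; ℝ)` (with respect to Lebesgue measure). -/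
abbrev L2p (d : ℕ) (p : ℝ) : Type :=
  Lp ℝ (ENNReal.ofReal (2 * p)) (volume : Measure (Rd d))

/-- The L-KS kernel in Fourier form, that is, the fundamental solution of
`∂ₜ u = -(1/8) (Δ + 2)² u` on `ℝ^d`:
`K_{t;x,y} = (2π)^{-d} ∫ exp(-(t/8) (-2 + |ξ|²)²) cos ⟨ξ, x - y⟩ dξ`, for `t > 0`. -/
def lksKernel (d : ℕ) (t : ℝ) (x y : Rd d) : ℝ :=
  ((2 * Real.pi) ^ d)⁻¹ *
    ∫ ξ : Rd d, Real.exp (-(t / 8) * (-2 + ‖ξ‖ ^ 2) ^ 2) * Real.cos (inner ℝ ξ (x - y))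

/-- The partial derivative `∂ K_{t;x,y} / ∂ y_ℓ` of the L-KS kernel. -/
def lksKernelDeriv (d : ℕ) (ℓ : Fin d) (t : ℝ) (x y : Rd d) : ℝ :=
  lineDeriv ℝ (fun y' : Rd d => lksKernel d t x y') y (EuclideanSpace.single ℓ 1)

/-- `(𝒦₀ z)(t,x) = ∫ K_{t;x,y} z(y) dy` for `t ≠ 0`, and `(𝒦₀ z)(0,x) = z(x)`. -/
def lksOpInit (d : ℕ) (z : Rd d → ℝ) (t : ℝ) (x : Rd d) : ℝ :=
  if t = 0 then z x else ∫ y : Rd d, lksKernel d t x y * z y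

/-- `(𝒦 u)(t,x) = ∫₀ᵗ ∫ K_{t-r;x,y} u(r,y) dy dr`. -/
def lksOp (d : ℕ) (u : ℝ → Rd d → ℝ) (t : ℝ) (x : Rd d) : ℝ :=
  ∫ r in (0 : ℝ)..t, ∫ y : Rd d, lksKernel d (t - r) x y * u r y

/-- `(𝒦_ℓ v)(t,x) = ∫₀ᵗ ∫ (∂ K_{t-r;x,y} / ∂ y_ℓ) v(r,y) dy dr`. -/
def lksOpDeriv (d : ℕ) (ℓ : Fin d) (v : ℝ → Rd d → ℝ) (t : ℝ) (x : Rd d) : ℝ :=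
  ∫ r in (0 : ℝ)..t, ∫ y : Rd d, lksKernelDeriv d ℓ (t - r) x y * v r y

/-- `U ∈ C([0,τ]; L^{2p}(ℝ^d; ℝ))` is an L-KS (kernel mild) solution on `[0,τ]` of the
Kuramoto–Sivashinsky–Burgers equation
`∂ₜ U = -(1/8) (Δ² + 4Δ) U - (1/2) ∑_ℓ ∂_ℓ (U²)`, `U(0,·) = u₀`.
Values of `U` outside `[0,τ]` are irrelevant. -/
structure IsLKSSolution (d : ℕ) (p : ℝ) [Fact (1 ≤ p)] (τ : ℝ)
    (u₀ : L2p d p) (U : ℝ → L2p d p) : Prop where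
  continuousOn : ContinuousOn U (Icc 0 τ)
  mild : ∀ t ∈ Icc 0 τ, ∀ᵐ x : Rd d,
    U t x = lksOpInit d u₀ t x
      + 1 / 2 * lksOp d (fun r y => U r y) t x
      + 1 / 2 * ∑ ℓ : Fin d, lksOpDeriv d ℓ (fun r y => (U r y) ^ 2) t x

end KSB

end

/-! Put t = c⁴. The substitution v = cξ turns the symbol exp(-(t/8)(|ξ|² - 2)²) into exp(-(1/8)(|v|²
- 2c²)²). These are Schwartz functions whose seminorms stay bounded while c² ranges over a compact
interval. Their Fourier transforms therefore decay rapidly, uniformly in c, and scaling back bounds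
the kernel (j = 0) and its first derivatives (j = 1) by C c^{-(d+j)} (1 + |z|/c)^{-(d+1)}
(`norm_lksOsc_le`, packaged in `IsParabolicKernel`).

With Young's inequality, convolution with K_t is bounded on L^{2p}, and convolution with a first
derivative maps L^p to L^{2p} with norm O(t^{-α}), where α = (1 + d/(2p))/4
(`exists_smoothing_zero`, `exists_smoothing_one`). The condition d < 6p says exactly that α < 1, so
the time singularity in the Duhamel integral is integrable.

Subtract the two mild equations and use |U₁² - U₂²|_p ≤ 2M |U₁ - U₂|_{2p}. Let n be the maximum over
r of e^{-λr} |U₁(r) - U₂(r)|_{2p}. The equation gives n ≤ A |u₁ - u₂|_{2p} + n (B₀ + B₁M) λ^{α-1}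
Γ(1-α) when the maximum is at a positive time (`exists_lks_difference_bound`). Choosing λ large in
terms of M makes the last term at most n/2, which is absorbed; this replaces a singular Gronwall
lemma.

The remaining work is measure-theoretic. Joint continuity of the inner integrals
(`continuousOn_kernelConv`) gives the measurability needed for Minkowski's inequality, and almost
everywhere integrability in time (`ae_integrableOn_kernelConv`) justifies subtracting the two
Duhamel integrals. -/

open scoped ENNReal

/-! ### Schwartz bounds for the rescaled symbol, uniform in ε. -/

/-- The rescaled symbol `exp (-(1/8) (|v|² - 2ε)²)`. -/
noncomputable def lksProfile (d : ℕ) (ε : ℝ) (v : KSB.Rd d) : ℝ :=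
  Real.exp (-(1 / 8) * (‖v‖ ^ 2 - 2 * ε) ^ 2)

theorem lksProfile_exponent_hasTemperateGrowth_bound (d : ℕ) (R : ℝ) (n : ℕ) :
    ∃ (C : ℝ) (k : ℕ), 1 ≤ C ∧ ∀ ε ∈ Icc 0 R, ∀ i ≤ n, ∀ v : KSB.Rd d,
      ‖iteratedFDeriv ℝ i (fun v : KSB.Rd d => -(1 / 8 : ℝ) * (‖v‖ ^ 2 - 2 * ε) ^ 2) v‖
        ≤ C * (1 + ‖v‖) ^ k := by
  have hN : (fun x : KSB.Rd d => ‖x‖ ^ 2).HasTemperateGrowth :=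
    Function.hasTemperateGrowth_norm_sq _
  have h1 : (fun x : KSB.Rd d => -(1 / 8 : ℝ) * (‖x‖ ^ 2) ^ 2).HasTemperateGrowth :=
    (Function.HasTemperateGrowth.const _).mul (hN.pow 2)
  obtain ⟨k₁, C₁, hC₁, H₁⟩ := h1.norm_iteratedFDeriv_le_uniform n
  obtain ⟨k₂, C₂, hC₂, H₂⟩ := hN.norm_iteratedFDeriv_le_uniform n
  refine ⟨1 + C₁ + |R| * C₂ + R ^ 2, max k₁ k₂, by have := abs_nonneg R; nlinarith [mul_nonneg this hC₂, sq_nonneg R], ?_⟩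
  intro ε hε i hi v
  -- Expanding the square leaves ε only in scalar coefficients of fixed functions of temperate
  -- growth, so uniformity in ε reduces to 0 ≤ ε ≤ R.
  have e : (fun v : KSB.Rd d => -(1 / 8 : ℝ) * (‖v‖ ^ 2 - 2 * ε) ^ 2)
      = (fun v : KSB.Rd d => -(1 / 8 : ℝ) * (‖v‖ ^ 2) ^ 2)
        + ((ε / 2) • (fun v : KSB.Rd d => ‖v‖ ^ 2) + fun _ => -(ε ^ 2 / 2)) := by
    funext v; simp only [Pi.add_apply, Pi.smul_apply, smul_eq_mul]; ring
  have c1 : ContDiffAt ℝ i (fun v : KSB.Rd d => -(1 / 8 : ℝ) * (‖v‖ ^ 2) ^ 2) v :=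
    (h1.1.of_le (mod_cast le_top)).contDiffAt
  have c2 : ContDiffAt ℝ i (fun v : KSB.Rd d => ‖v‖ ^ 2) v :=
    (hN.1.of_le (mod_cast le_top)).contDiffAt
  have c2' : ContDiffAt ℝ i ((ε / 2) • fun v : KSB.Rd d => ‖v‖ ^ 2) v := c2.const_smul (ε / 2)
  have c3 : ContDiffAt ℝ i (fun _ : KSB.Rd d => -(ε ^ 2 / 2)) v := contDiffAt_const
  have c4 : ContDiffAt ℝ i (((ε / 2) • fun v : KSB.Rd d => ‖v‖ ^ 2) + fun _ => -(ε ^ 2 / 2)) v :=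
    c2'.add c3
  rw [e, iteratedFDeriv_add_apply c1 c4, iteratedFDeriv_add_apply c2' c3,
    iteratedFDeriv_const_smul_apply c2]
  have hv : (1 : ℝ) ≤ 1 + ‖v‖ := by linarith [norm_nonneg v]
  have hk1 := pow_le_pow_right₀ hv (le_max_left k₁ k₂)
  have hk2 := pow_le_pow_right₀ hv (le_max_right k₁ k₂)
  have hk0 := one_le_pow₀ (n := max k₁ k₂) hv
  have b3 : ‖iteratedFDeriv ℝ i (fun _ : KSB.Rd d => -(ε ^ 2 / 2)) v‖ ≤ R ^ 2 := by
    rcases Nat.eq_zero_or_pos i with rfl | hi0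
    · rw [norm_iteratedFDeriv_zero, norm_neg, Real.norm_of_nonneg (by positivity)]
      nlinarith [hε.1, hε.2]
    · rw [iteratedFDeriv_const_of_ne hi0.ne']
      simpa using sq_nonneg R
  have b1 := H₁ i hi v
  have b2 := H₂ i hi v
  have hε2 : |ε / 2| ≤ |R| := by
    rw [abs_of_nonneg (by linarith [hε.1]), abs_of_nonneg (hε.1.trans hε.2)]
    linarith [hε.1, hε.2]
  calc _ ≤ C₁ * (1 + ‖v‖) ^ k₁ + (|R| * (C₂ * (1 + ‖v‖) ^ k₂) + R ^ 2) := by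
        refine (norm_add_le _ _).trans (add_le_add b1 ((norm_add_le _ _).trans (add_le_add ?_ b3)))
        rw [norm_smul, Real.norm_eq_abs]
        gcongr
    _ ≤ C₁ * (1 + ‖v‖) ^ (max k₁ k₂) + (|R| * (C₂ * (1 + ‖v‖) ^ (max k₁ k₂))
          + R ^ 2 * (1 + ‖v‖) ^ (max k₁ k₂)) := by
        gcongr
        exact le_mul_of_one_le_right (sq_nonneg R) hk0
    _ ≤ _ := by
        nlinarith

theorem contDiff_lksProfile (d : ℕ) (ε : ℝ) (n : ℕ∞) : ContDiff ℝ n (lksProfile d ε) := by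
  unfold lksProfile
  exact ((contDiff_const.mul (((contDiff_norm_sq ℝ).sub contDiff_const).pow 2))).exp

/-- By Faà di Bruno, each derivative of the exponential is the exponential times polynomially
bounded factors; Leibniz then brings in q, and the binomial sum costs 2^n. -/
theorem norm_iteratedFDeriv_mul_lksProfile_le (d : ℕ) {q : KSB.Rd d → ℝ}
    (hq : q.HasTemperateGrowth) (R : ℝ) (n : ℕ) :
    ∃ (C : ℝ) (k : ℕ), 0 ≤ C ∧ ∀ ε ∈ Icc 0 R, ∀ i ≤ n, ∀ v : KSB.Rd d,
      ‖iteratedFDeriv ℝ i (fun v => q v * lksProfile d ε v) v‖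
        ≤ C * (1 + ‖v‖) ^ k * lksProfile d ε v := by
  obtain ⟨C₁, k₁, hC₁, H₁⟩ := lksProfile_exponent_hasTemperateGrowth_bound d R n
  obtain ⟨k₂, C₂, hC₂, H₂⟩ := hq.norm_iteratedFDeriv_le_uniform n
  refine ⟨2 ^ n * (C₂ * (n.factorial * C₁ ^ n)), k₂ + k₁ * n, by positivity, ?_⟩
  intro ε hε i hi v
  have hv : (1 : ℝ) ≤ 1 + ‖v‖ := by linarith [norm_nonneg v]
  have hprof : ∀ j ≤ n, ‖iteratedFDeriv ℝ j (lksProfile d ε) v‖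
      ≤ n.factorial * lksProfile d ε v * (C₁ * (1 + ‖v‖) ^ k₁) ^ n := by
    intro j hj
    -- The composition bound wants the i-th inner derivative below D^i; a single D works because D ≥
    -- 1 and i ≥ 1.
    have hD1 : 1 ≤ C₁ * (1 + ‖v‖) ^ k₁ := one_le_mul_of_one_le_of_one_le hC₁ (one_le_pow₀ hv)
    have := norm_iteratedFDeriv_comp_le (𝕜 := ℝ) (N := j) (n := j) (g := Real.exp)
      (f := fun v : KSB.Rd d => -(1 / 8 : ℝ) * (‖v‖ ^ 2 - 2 * ε) ^ 2)
      Real.contDiff_exp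
      (contDiff_const.mul (((contDiff_norm_sq ℝ).sub contDiff_const).pow 2)) le_rfl v
      (C := lksProfile d ε v) (D := C₁ * (1 + ‖v‖) ^ k₁)
      (fun i _ => by
        rw [norm_iteratedFDeriv_eq_norm_iteratedDeriv, iteratedDeriv_eq_iterate,
          Real.iter_deriv_exp, Real.norm_of_nonneg (Real.exp_pos _).le]
        rfl)
      (fun i hi1 hi2 => (H₁ ε hε i (hi2.trans hj) v).trans (le_self_pow₀ hD1 (by omega)))
    refine this.trans ?_
    have hpos : 0 ≤ lksProfile d ε v := (Real.exp_pos _).le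
    gcongr
  have hpos : 0 ≤ lksProfile d ε v := (Real.exp_pos _).le
  calc _ ≤ ∑ j ∈ Finset.range (i + 1), (i.choose j : ℝ) * ‖iteratedFDeriv ℝ j q v‖ *
        ‖iteratedFDeriv ℝ (i - j) (lksProfile d ε) v‖ :=
        norm_iteratedFDeriv_mul_le (N := i) (hq.1.of_le (mod_cast le_top))
          (contDiff_lksProfile d ε i) v le_rfl
    _ ≤ ∑ j ∈ Finset.range (i + 1), (i.choose j : ℝ) * (C₂ * (1 + ‖v‖) ^ k₂) *
        (n.factorial * lksProfile d ε v * (C₁ * (1 + ‖v‖) ^ k₁) ^ n) := by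
        refine Finset.sum_le_sum fun j hj => ?_
        have hj' : j ≤ n := by have := Finset.mem_range.1 hj; omega
        gcongr
        · exact H₂ j hj' v
        · exact hprof (i - j) (by omega)
    _ = 2 ^ i * ((C₂ * (1 + ‖v‖) ^ k₂) *
        (n.factorial * lksProfile d ε v * (C₁ * (1 + ‖v‖) ^ k₁) ^ n)) := by
        simp_rw [mul_assoc (Nat.cast _ : ℝ)]
        rw [← Finset.sum_mul]
        congr 1
        exact_mod_cast Nat.sum_range_choose i
    _ ≤ 2 ^ n * ((C₂ * (1 + ‖v‖) ^ k₂) *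
        (n.factorial * lksProfile d ε v * (C₁ * (1 + ‖v‖) ^ k₁) ^ n)) := by
        gcongr
        norm_num
    _ = _ := by rw [mul_pow, pow_add, pow_mul]; ring

theorem one_add_norm_pow_mul_lksProfile_le (d : ℕ) (R : ℝ) (m : ℕ) :
    ∃ C : ℝ, 0 ≤ C ∧ ∀ ε ∈ Icc 0 R, ∀ v : KSB.Rd d,
      (1 + ‖v‖) ^ m * lksProfile d ε v ≤ C := by
  refine ⟨m.factorial * Real.exp (3 + R ^ 2 / 2), by positivity, ?_⟩
  intro ε hε v
  have h1 : (1 + ‖v‖) ^ m ≤ m.factorial * Real.exp (1 + ‖v‖) := by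
    have := Real.pow_div_factorial_le_exp (1 + ‖v‖) (by positivity) m
    rwa [div_le_iff₀ (by positivity), mul_comm] at this
  -- Since (|v|² - 2ε)² ≥ |v|⁴/2 - 4ε², the quartic absorbs |v| at a cost of at most ε²/2 plus a
  -- constant.
  have h2 : 1 + ‖v‖ + -(1 / 8) * (‖v‖ ^ 2 - 2 * ε) ^ 2 ≤ 3 + R ^ 2 / 2 := by
    have hR : ε ^ 2 ≤ R ^ 2 := pow_le_pow_left₀ hε.1 hε.2 2
    nlinarith [sq_nonneg (‖v‖ ^ 2 - 4 * ε), sq_nonneg (‖v‖ ^ 2 - 4), sq_nonneg (‖v‖ - 1)]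
  calc _ ≤ m.factorial * Real.exp (1 + ‖v‖) * lksProfile d ε v := by
        have hpos : 0 ≤ lksProfile d ε v := (Real.exp_pos _).le
        gcongr
    _ = m.factorial * Real.exp (1 + ‖v‖ + -(1 / 8) * (‖v‖ ^ 2 - 2 * ε) ^ 2) := by
        rw [lksProfile, Real.exp_add _ (-(1 / 8) * _), mul_assoc]
    _ ≤ _ := by gcongr

/-- The power d + 1 makes the right side integrable on ℝ^d, giving one integrable majorant for all
ε. -/
theorem pow_mul_norm_iteratedFDeriv_mul_lksProfile_le (d : ℕ) {q : KSB.Rd d → ℝ}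
    (hq : q.HasTemperateGrowth) (R : ℝ) (a n : ℕ) :
    ∃ C : ℝ, 0 ≤ C ∧ ∀ ε ∈ Icc 0 R, ∀ i ≤ n, ∀ v : KSB.Rd d,
      ‖v‖ ^ a * ‖iteratedFDeriv ℝ i (fun v => q v * lksProfile d ε v) v‖
        ≤ C * (1 + ‖v‖) ^ (-((d + 1 : ℕ) : ℝ)) := by
  obtain ⟨C₁, k, hC₁, H₁⟩ := norm_iteratedFDeriv_mul_lksProfile_le d hq R n
  obtain ⟨C₂, hC₂, H₂⟩ := one_add_norm_pow_mul_lksProfile_le d R (a + k + (d + 1))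
  refine ⟨C₁ * C₂, by positivity, fun ε hε i hi v => ?_⟩
  have hpos : 0 ≤ lksProfile d ε v := (Real.exp_pos _).le
  rw [Real.rpow_neg (by positivity), Real.rpow_natCast, ← div_eq_mul_inv,
    le_div_iff₀ (by positivity)]
  calc _ ≤ (1 + ‖v‖) ^ a * (C₁ * (1 + ‖v‖) ^ k * lksProfile d ε v) * (1 + ‖v‖) ^ (d + 1) := by
        gcongr
        · linarith
        · exact H₁ ε hε i hi v
    _ = C₁ * ((1 + ‖v‖) ^ (a + k + (d + 1)) * lksProfile d ε v) := by
        rw [pow_add, pow_add]; ring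
    _ ≤ _ := by gcongr; exact H₂ ε hε v

-- Powers of w are traded for derivatives of the integrand, whose L¹ norms are bounded uniformly in
-- ε. The cases of power 0 and n combine through (1 + a)^n ≤ 2^n (1 + a^n).
open FourierTransform in
theorem norm_fourier_mul_lksProfile_le (d : ℕ) {q : KSB.Rd d → ℝ}
    (hq : q.HasTemperateGrowth) (R : ℝ) (n : ℕ) :
    ∃ C : ℝ, 0 ≤ C ∧ ∀ ε ∈ Icc 0 R, ∀ w : KSB.Rd d,
      ‖𝓕 (fun v : KSB.Rd d => ((q v * lksProfile d ε v : ℝ) : ℂ)) w‖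
        ≤ C * (1 + ‖w‖) ^ (-(n : ℝ)) := by
  obtain ⟨C₁, hC₁, H₁⟩ := pow_mul_norm_iteratedFDeriv_mul_lksProfile_le d hq R 0 n
  set I : ℝ := ∫ v : KSB.Rd d, (1 + ‖v‖) ^ (-((d + 1 : ℕ) : ℝ)) with hI
  have hint : Integrable (fun v : KSB.Rd d => (1 + ‖v‖) ^ (-((d + 1 : ℕ) : ℝ))) :=
    integrable_one_add_norm (by simp)
  have hI0 : 0 ≤ I := integral_nonneg fun v => by positivity
  have key : ∀ ε ∈ Icc 0 R, ∀ m ≤ n, ∀ w : KSB.Rd d,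
      ‖w‖ ^ m * ‖𝓕 (fun v : KSB.Rd d => ((q v * lksProfile d ε v : ℝ) : ℂ)) w‖
        ≤ 2 ^ n * ((n + 1) * (C₁ * I)) := by
    intro ε hε m hm w
    have hsm : ContDiff ℝ n (fun v => q v * lksProfile d ε v) :=
      (hq.1.of_le (mod_cast le_top)).mul (contDiff_lksProfile d ε n)
    have hsmC : ContDiff ℝ n (fun v : KSB.Rd d => ((q v * lksProfile d ε v : ℝ) : ℂ)) :=
      Complex.ofRealCLM.contDiff.comp hsm
    have hnorm : ∀ i ≤ n, ∀ v, ‖iteratedFDeriv ℝ i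
        (fun v : KSB.Rd d => ((q v * lksProfile d ε v : ℝ) : ℂ)) v‖
        = ‖iteratedFDeriv ℝ i (fun v => q v * lksProfile d ε v) v‖ := by
      intro i hi v
      exact Complex.ofRealLI.norm_iteratedFDeriv_comp_left (hsm.contDiffAt (x := v))
        (mod_cast hi)
    have hInt : ∀ k i : ℕ, i ≤ n → Integrable (fun v => ‖v‖ ^ k * ‖iteratedFDeriv ℝ i
        (fun v : KSB.Rd d => ((q v * lksProfile d ε v : ℝ) : ℂ)) v‖) := by
      intro k i hi
      obtain ⟨C₂, hC₂, H₂⟩ := pow_mul_norm_iteratedFDeriv_mul_lksProfile_le d hq R k n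
      refine (hint.const_mul C₂).mono' ?_ (Filter.Eventually.of_forall fun v => ?_)
      · refine Continuous.aestronglyMeasurable ?_
        exact (continuous_norm.pow k).mul (hsmC.continuous_iteratedFDeriv (mod_cast hi)).norm
      · rw [Real.norm_of_nonneg (by positivity), hnorm i hi]
        exact H₂ ε hε i hi v
    have := Real.pow_mul_norm_iteratedFDeriv_fourier_le (K := 0) (N := n) (k := 0) (n := m)
      hsmC (fun k i _ hi => hInt k i (mod_cast hi)) le_rfl (mod_cast hm) w
    rw [norm_iteratedFDeriv_zero] at this
    refine this.trans ?_
    have hsum : ∑ p ∈ Finset.range (0 + 1) ×ˢ Finset.range (m + 1),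
        ∫ v, ‖v‖ ^ p.1 * ‖iteratedFDeriv ℝ p.2
          (fun v : KSB.Rd d => ((q v * lksProfile d ε v : ℝ) : ℂ)) v‖
        ≤ (n + 1) * (C₁ * I) := by
      calc _ ≤ ∑ p ∈ Finset.range (0 + 1) ×ˢ Finset.range (m + 1), C₁ * I := by
            refine Finset.sum_le_sum fun p hp => ?_
            rw [Finset.mem_product, Finset.mem_range, Finset.mem_range] at hp
            have hp1 : p.1 = 0 := by omega
            have hp2 : p.2 ≤ n := by omega
            rw [hI, ← integral_const_mul]
            refine integral_mono (hInt _ _ hp2) (hint.const_mul C₁) fun v => ?_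
            simp only [hp1]
            rw [hnorm _ hp2]
            exact H₁ ε hε _ hp2 v
        _ = (m + 1) * (C₁ * I) := by simp
        _ ≤ _ := by gcongr
    calc _ ≤ 2 ^ m * ((n + 1) * (C₁ * I)) := by
          simp only [pow_zero, one_mul, Nat.cast_zero, mul_zero, zero_add]
          gcongr
      _ ≤ _ := by gcongr; norm_num
  refine ⟨2 ^ n * (2 * (2 ^ n * ((n + 1) * (C₁ * I)))), by positivity, fun ε hε w => ?_⟩
  rw [Real.rpow_neg (by positivity), Real.rpow_natCast, ← div_eq_mul_inv,
    le_div_iff₀ (by positivity)]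
  have h0 := key ε hε 0 (Nat.zero_le _) w
  have hn := key ε hε n le_rfl w
  have hp : (1 + ‖w‖) ^ n ≤ 2 ^ n * (1 + ‖w‖ ^ n) := by
    rcases le_total ‖w‖ 1 with h | h
    · calc (1 + ‖w‖) ^ n ≤ 2 ^ n := by gcongr; linarith
        _ ≤ _ := le_mul_of_one_le_right (by positivity) (by linarith [pow_nonneg (norm_nonneg w) n])
    · calc (1 + ‖w‖) ^ n ≤ (2 * ‖w‖) ^ n := by gcongr; linarith
        _ = 2 ^ n * ‖w‖ ^ n := mul_pow _ _ _
        _ ≤ _ := by gcongr; linarith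
  calc _ ≤ ‖𝓕 (fun v : KSB.Rd d => ((q v * lksProfile d ε v : ℝ) : ℂ)) w‖
        * (2 ^ n * (1 + ‖w‖ ^ n)) := by gcongr
    _ ≤ _ := by rw [pow_zero] at h0; rw [mul_left_comm]; exact mul_le_mul_of_nonneg_left (by linarith) (by positivity)

/-! ### Parabolic scaling and the Fourier form of the kernels. -/

open FourierTransform in
/-- The oscillatory integral `∫ q(ξ) exp (-(t/8) (-2 + |ξ|²)²) e^{-2πi ⟨ξ, w⟩} dξ`. -/
noncomputable def lksOsc (d : ℕ) (q : KSB.Rd d → ℝ) (t : ℝ) (w : KSB.Rd d) : ℂ :=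
  𝓕 (fun ξ : KSB.Rd d => ((q ξ * Real.exp (-(t / 8) * (-2 + ‖ξ‖ ^ 2) ^ 2) : ℝ) : ℂ)) w

/-- The fourth-order part is invariant under ξ ↦ cξ with t = c⁴; the lower-order part survives as
the parameter ε = c², which is bounded on bounded time intervals. -/
theorem lksSymbol_eq (d j : ℕ) {q : KSB.Rd d → ℝ}
    (hj : ∀ c : ℝ, ∀ v, q (c • v) = c ^ j * q v) {c : ℝ} (hc : 0 < c) (ξ : KSB.Rd d) :
    q ξ * Real.exp (-(c ^ 4 / 8) * (-2 + ‖ξ‖ ^ 2) ^ 2)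
      = (c ^ j)⁻¹ * (q (c • ξ) * lksProfile d (c ^ 2) (c • ξ)) := by
  rw [hj, lksProfile, norm_smul, Real.norm_of_nonneg hc.le]
  have : -(c ^ 4 / 8) * (-2 + ‖ξ‖ ^ 2) ^ 2 = -(1 / 8) * ((c * ‖ξ‖) ^ 2 - 2 * c ^ 2) ^ 2 := by ring
  rw [this]
  field_simp

theorem integrable_mul_lksProfile (d : ℕ) {q : KSB.Rd d → ℝ} (hq : q.HasTemperateGrowth)
    {ε : ℝ} (hε : 0 ≤ ε) : Integrable (fun v => q v * lksProfile d ε v) := by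
  obtain ⟨C, hC, H⟩ := pow_mul_norm_iteratedFDeriv_mul_lksProfile_le d hq ε 0 0
  have hint : Integrable (fun v : KSB.Rd d => (1 + ‖v‖) ^ (-((d + 1 : ℕ) : ℝ))) :=
    integrable_one_add_norm (by simp)
  refine (hint.const_mul C).mono' ?_ (Filter.Eventually.of_forall fun v => ?_)
  · exact (hq.1.continuous.mul (contDiff_lksProfile d ε 0).continuous).aestronglyMeasurable
  · simpa using H ε ⟨hε, le_rfl⟩ 0 le_rfl v

theorem exists_pow_four {t : ℝ} (ht : 0 < t) : ∃ c : ℝ, 0 < c ∧ c ^ 4 = t :=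
  ⟨t ^ (1 / 4 : ℝ), by positivity, by
    rw [← Real.rpow_natCast, ← Real.rpow_mul ht.le]; norm_num⟩

theorem integrable_lksSymbol (d j : ℕ) {q : KSB.Rd d → ℝ} (hq : q.HasTemperateGrowth)
    (hj : ∀ c : ℝ, ∀ v, q (c • v) = c ^ j * q v) {t : ℝ} (ht : 0 < t) :
    Integrable (fun ξ => q ξ * Real.exp (-(t / 8) * (-2 + ‖ξ‖ ^ 2) ^ 2)) := by
  obtain ⟨c, hc, rfl⟩ := exists_pow_four ht
  simp_rw [lksSymbol_eq d j hj hc]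
  exact ((integrable_mul_lksProfile d hq (sq_nonneg c)).comp_smul hc.ne').const_mul _

-- Substituting u = cξ contributes the Jacobian c^{-d}, and the homogeneity of q contributes c^{-j}.
open FourierTransform in
theorem lksOsc_eq_scaled (d j : ℕ) {q : KSB.Rd d → ℝ}
    (hj : ∀ c : ℝ, ∀ v, q (c • v) = c ^ j * q v) {c : ℝ} (hc : 0 < c) (w : KSB.Rd d) :
    lksOsc d q (c ^ 4) w = (((c ^ (d + j))⁻¹ : ℝ) : ℂ) *
      𝓕 (fun v : KSB.Rd d => ((q v * lksProfile d (c ^ 2) v : ℝ) : ℂ)) (c⁻¹ • w) := by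
  rw [lksOsc, Real.fourier_eq, Real.fourier_eq]
  have e : ∀ v : KSB.Rd d, Real.fourierChar (-inner ℝ v w) •
      ((q v * Real.exp (-(c ^ 4 / 8) * (-2 + ‖v‖ ^ 2) ^ 2) : ℝ) : ℂ)
      = (((c ^ j)⁻¹ : ℝ) : ℂ) * (fun u : KSB.Rd d => Real.fourierChar (-inner ℝ u (c⁻¹ • w)) •
        ((q u * lksProfile d (c ^ 2) u : ℝ) : ℂ)) (c • v) := by
    intro v
    rw [lksSymbol_eq d j hj hc]
    simp only [inner_smul_left, inner_smul_right, Circle.smul_def, smul_eq_mul]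
    rw [show c⁻¹ * ((starRingEnd ℝ) c * inner ℝ v w) = inner ℝ v w by
      simp [inv_mul_cancel_left₀ hc.ne']]
    push_cast
    ring
  rw [integral_congr_ae (Filter.Eventually.of_forall e), integral_const_mul,
    Measure.integral_comp_smul_of_nonneg volume (fun u : KSB.Rd d =>
      Real.fourierChar (-inner ℝ u (c⁻¹ • w)) • ((q u * lksProfile d (c ^ 2) u : ℝ) : ℂ)) c
      (hR := hc.le)]
  simp only [finrank_euclideanSpace, Fintype.card_fin, Complex.real_smul]
  rw [pow_add, mul_inv]
  push_cast
  ring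

theorem norm_lksOsc_le (d j : ℕ) {q : KSB.Rd d → ℝ} (hq : q.HasTemperateGrowth)
    (hj : ∀ c : ℝ, ∀ v, q (c • v) = c ^ j * q v) (R : ℝ) (n : ℕ) :
    ∃ C : ℝ, 0 ≤ C ∧ ∀ c : ℝ, 0 < c → c ≤ R → ∀ w,
      ‖lksOsc d q (c ^ 4) w‖ ≤ C * (c ^ (d + j))⁻¹ * (1 + ‖w‖ / c) ^ (-(n : ℝ)) := by
  obtain ⟨C, hC, H⟩ := norm_fourier_mul_lksProfile_le d hq (R ^ 2) n
  refine ⟨C, hC, fun c hc hcR w => ?_⟩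
  rw [lksOsc_eq_scaled d j hj hc, norm_mul, Complex.norm_real, Real.norm_of_nonneg (by positivity)]
  have := H (c ^ 2) ⟨by positivity, by gcongr⟩ (c⁻¹ • w)
  rw [norm_smul, norm_inv, Real.norm_of_nonneg hc.le, inv_mul_eq_div] at this
  calc _ ≤ (c ^ (d + j))⁻¹ * (C * (1 + ‖w‖ / c) ^ (-(n : ℝ))) := by gcongr
    _ = _ := by ring

theorem continuousOn_lksOsc (d j : ℕ) {q : KSB.Rd d → ℝ} (hq : q.HasTemperateGrowth)
    (hj : ∀ c : ℝ, ∀ v, q (c • v) = c ^ j * q v) :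
    ContinuousOn (fun a : ℝ × KSB.Rd d => lksOsc d q a.1 a.2) (Ioi 0 ×ˢ univ) := by
  rintro ⟨t₀, w₀⟩ ⟨ht₀, -⟩
  have ht₀ : 0 < t₀ := ht₀
  refine ContinuousAt.continuousWithinAt ?_
  simp only [lksOsc, Real.fourier_eq]
  have hqc := hq.1.continuous
  -- The symbol decreases in t, so its value at t₀/2 dominates it for all t near t₀.
  refine continuousAt_of_dominated
    (bound := fun ξ => ‖q ξ * Real.exp (-(t₀ / 2 / 8) * (-2 + ‖ξ‖ ^ 2) ^ 2)‖) ?_ ?_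
    (integrable_lksSymbol d j hq hj (half_pos ht₀)).norm ?_
  · refine Filter.Eventually.of_forall fun a => Continuous.aestronglyMeasurable ?_
    simp only [Circle.smul_def]
    fun_prop
  · have : ∀ᶠ a : ℝ × KSB.Rd d in nhds (t₀, w₀), t₀ / 2 < a.1 :=
      continuous_fst.continuousAt.eventually (lt_mem_nhds (by simpa using half_lt_self ht₀))
    filter_upwards [this] with a ha
    refine Filter.Eventually.of_forall fun ξ => ?_
    rw [Circle.norm_smul, Complex.norm_real, norm_mul, norm_mul]
    gcongr
    rw [Real.norm_of_nonneg (Real.exp_pos _).le, Real.norm_of_nonneg (Real.exp_pos _).le]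
    gcongr
  · refine Filter.Eventually.of_forall fun ξ => Continuous.continuousAt ?_
    simp only [Circle.smul_def]
    fun_prop

/-- The argument z/(2π) converts the e^{-2πi⟨ξ,w⟩} convention of the Fourier transform into the
phase ⟨ξ, z⟩ of the kernel. -/
theorem lksOsc_eq_integral (d : ℕ) (q : KSB.Rd d → ℝ) (t : ℝ) (z : KSB.Rd d) :
    lksOsc d q t ((2 * Real.pi)⁻¹ • z) = ∫ ξ : KSB.Rd d,
      Complex.exp (((-inner ℝ ξ z : ℝ) : ℂ) * Complex.I) *
        ((q ξ * Real.exp (-(t / 8) * (-2 + ‖ξ‖ ^ 2) ^ 2) : ℝ) : ℂ) := by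
  rw [lksOsc, Real.fourier_eq]
  congr 1
  funext ξ
  rw [Circle.smul_def, Real.fourierChar_apply, smul_eq_mul, inner_smul_right]
  congr 3
  have := Real.pi_ne_zero
  field_simp

theorem integrable_lksOsc_integrand (d j : ℕ) {q : KSB.Rd d → ℝ} (hq : q.HasTemperateGrowth)
    (hj : ∀ c : ℝ, ∀ v, q (c • v) = c ^ j * q v) {t : ℝ} (ht : 0 < t) (z : KSB.Rd d) :
    Integrable fun ξ : KSB.Rd d => Complex.exp (((-inner ℝ ξ z : ℝ) : ℂ) * Complex.I) *
        ((q ξ * Real.exp (-(t / 8) * (-2 + ‖ξ‖ ^ 2) ^ 2) : ℝ) : ℂ) := by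
  refine (integrable_lksSymbol d j hq hj ht).ofReal.bdd_mul (c := 1) ?_ ?_
  · exact Continuous.aestronglyMeasurable (by fun_prop)
  · exact Filter.Eventually.of_forall fun ξ => (Complex.norm_exp_ofReal_mul_I _).le

theorem re_lksOsc (d j : ℕ) {q : KSB.Rd d → ℝ} (hq : q.HasTemperateGrowth)
    (hj : ∀ c : ℝ, ∀ v, q (c • v) = c ^ j * q v) {t : ℝ} (ht : 0 < t) (z : KSB.Rd d) :
    (lksOsc d q t ((2 * Real.pi)⁻¹ • z)).re = ∫ ξ : KSB.Rd d,
      q ξ * Real.exp (-(t / 8) * (-2 + ‖ξ‖ ^ 2) ^ 2) * Real.cos (inner ℝ ξ z) := by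
  rw [lksOsc_eq_integral]
  refine ((Complex.reCLM.integral_comp_comm
    (integrable_lksOsc_integrand d j hq hj ht z)).symm).trans (integral_congr_ae ?_)
  refine Filter.Eventually.of_forall fun ξ => ?_
  simp only [Complex.reCLM_apply, Complex.mul_re, Complex.ofReal_re, Complex.ofReal_im, mul_zero,
    sub_zero, Complex.exp_ofReal_mul_I_re, Real.cos_neg]
  ring

theorem im_lksOsc (d j : ℕ) {q : KSB.Rd d → ℝ} (hq : q.HasTemperateGrowth)
    (hj : ∀ c : ℝ, ∀ v, q (c • v) = c ^ j * q v) {t : ℝ} (ht : 0 < t) (z : KSB.Rd d) :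
    (lksOsc d q t ((2 * Real.pi)⁻¹ • z)).im = -∫ ξ : KSB.Rd d,
      q ξ * Real.exp (-(t / 8) * (-2 + ‖ξ‖ ^ 2) ^ 2) * Real.sin (inner ℝ ξ z) := by
  rw [lksOsc_eq_integral, ← integral_neg]
  refine ((Complex.imCLM.integral_comp_comm
    (integrable_lksOsc_integrand d j hq hj ht z)).symm).trans (integral_congr_ae ?_)
  refine Filter.Eventually.of_forall fun ξ => ?_
  simp only [Complex.imCLM_apply, Complex.mul_im, Complex.ofReal_re, Complex.ofReal_im, mul_zero,
    zero_add, Complex.exp_ofReal_mul_I_im, Real.sin_neg]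
  ring

theorem one_homogeneous (d : ℕ) (c : ℝ) (v : KSB.Rd d) :
    (fun _ : KSB.Rd d => (1 : ℝ)) (c • v) = c ^ 0 * (fun _ : KSB.Rd d => (1 : ℝ)) v := by simp

theorem coord_homogeneous (d : ℕ) (ℓ : Fin d) (c : ℝ) (v : KSB.Rd d) :
    (fun ξ : KSB.Rd d => ξ ℓ) (c • v) = c ^ 1 * (fun ξ : KSB.Rd d => ξ ℓ) v := by simp

theorem coord_hasTemperateGrowth (d : ℕ) (ℓ : Fin d) :
    (fun ξ : KSB.Rd d => ξ ℓ).HasTemperateGrowth :=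
  (EuclideanSpace.proj ℓ : KSB.Rd d →L[ℝ] ℝ).hasTemperateGrowth

theorem lksKernel_eq_re_lksOsc (d : ℕ) {t : ℝ} (ht : 0 < t) (x y : KSB.Rd d) :
    KSB.lksKernel d t x y = ((2 * Real.pi) ^ d)⁻¹ *
      (lksOsc d (fun _ => 1) t ((2 * Real.pi)⁻¹ • (x - y))).re := by
  rw [re_lksOsc d 0 (.const 1) (one_homogeneous d) ht, KSB.lksKernel]
  simp only [one_mul]

/-- Differentiating cos⟨ξ, x - y⟩ in y_ℓ under the integral gives ξ_ℓ sin⟨ξ, x - y⟩; the modulus of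
ξ_ℓ times the symbol is an integrable majorant. -/
theorem lksKernelDeriv_eq_im_lksOsc (d : ℕ) (ℓ : Fin d) {t : ℝ} (ht : 0 < t) (x y : KSB.Rd d) :
    KSB.lksKernelDeriv d ℓ t x y = -((2 * Real.pi) ^ d)⁻¹ *
      (lksOsc d (fun ξ => ξ ℓ) t ((2 * Real.pi)⁻¹ • (x - y))).im := by
  rw [im_lksOsc d 1 (coord_hasTemperateGrowth d ℓ) (coord_homogeneous d ℓ) ht, neg_mul_neg]
  refine HasLineDerivAt.lineDeriv ?_
  unfold HasLineDerivAt KSB.lksKernel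
  refine HasDerivAt.const_mul _ ?_
  have := (hasDerivAt_integral_of_dominated_loc_of_deriv_le (x₀ := (0 : ℝ)) (s := univ)
    (F := fun s (ξ : KSB.Rd d) => Real.exp (-(t / 8) * (-2 + ‖ξ‖ ^ 2) ^ 2) *
      Real.cos (inner ℝ ξ (x - (y + s • EuclideanSpace.single ℓ (1 : ℝ)))))
    (F' := fun s (ξ : KSB.Rd d) => ξ ℓ * Real.exp (-(t / 8) * (-2 + ‖ξ‖ ^ 2) ^ 2) *
      Real.sin (inner ℝ ξ (x - (y + s • EuclideanSpace.single ℓ (1 : ℝ)))))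
    (μ := volume)
    (bound := fun ξ : KSB.Rd d => ‖ξ ℓ * Real.exp (-(t / 8) * (-2 + ‖ξ‖ ^ 2) ^ 2)‖)
    Filter.univ_mem
    (Filter.Eventually.of_forall fun s => Continuous.aestronglyMeasurable (by fun_prop))
    ?_ (Continuous.aestronglyMeasurable (by fun_prop))
    (Filter.Eventually.of_forall fun ξ s _ => ?_)
    (integrable_lksSymbol d 1 (coord_hasTemperateGrowth d ℓ) (coord_homogeneous d ℓ) ht).norm
    (Filter.Eventually.of_forall fun ξ s _ => ?_)).2
  · simpa using this
  · have h1 := integrable_lksSymbol d 0 (q := fun _ => (1 : ℝ)) (.const 1) (one_homogeneous d) ht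
    simp only [one_mul] at h1
    refine h1.mul_bdd (c := 1) (Continuous.aestronglyMeasurable (by fun_prop)) ?_
    exact Filter.Eventually.of_forall fun ξ => Real.abs_cos_le_one _
  · rw [norm_mul]
    exact mul_le_of_le_one_right (norm_nonneg _) (Real.abs_sin_le_one _)
  · have h2 : HasDerivAt (fun s : ℝ => inner ℝ ξ (x - (y + s • EuclideanSpace.single ℓ (1 : ℝ))))
        (-ξ ℓ) s := by
      have e : (fun s : ℝ => inner ℝ ξ (x - (y + s • EuclideanSpace.single ℓ (1 : ℝ))))
          = fun s : ℝ => inner ℝ ξ (x - y) - s * ξ ℓ := by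
        funext s
        rw [← sub_sub, inner_sub_right, inner_smul_right, EuclideanSpace.inner_single_right]
        simp
      rw [e]
      simpa using ((hasDerivAt_id s).mul_const (ξ ℓ)).const_sub (inner ℝ ξ (x - y))
    refine (h2.cos.const_mul (Real.exp (-(t / 8) * (-2 + ‖ξ‖ ^ 2) ^ 2))).congr_deriv ?_
    ring

/-! ### Pointwise kernel bounds. -/

/-- A convolution kernel `κ t z`, jointly continuous for `t > 0`, with the pointwise bound
`|κ (c⁴) z| ≤ C c^{-(d+j)} (1 + |z|/c)^{-(d+1)}` for `0 < c ≤ R`. -/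
structure IsParabolicKernel (d j : ℕ) (R C : ℝ) (κ : ℝ → KSB.Rd d → ℝ) : Prop where
  continuousOn : ContinuousOn (fun a : ℝ × KSB.Rd d => κ a.1 a.2) (Ioi 0 ×ˢ univ)
  bound : ∀ c : ℝ, 0 < c → c ≤ R → ∀ z,
    |κ (c ^ 4) z| ≤ C * (c ^ (d + j))⁻¹ * (1 + ‖z‖ / c) ^ (-((d + 1 : ℕ) : ℝ))

/-- Taking L to be the real or the imaginary part covers the kernel and its derivatives at once;
undoing the factor 2π in the argument costs (2π)^{d+1}. -/
theorem exists_isParabolicKernel_of_lksOsc (d j : ℕ) {q : KSB.Rd d → ℝ}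
    (hq : q.HasTemperateGrowth) (hj : ∀ c : ℝ, ∀ v, q (c • v) = c ^ j * q v) (R a : ℝ)
    (L : ℂ →L[ℝ] ℝ) (hL : ∀ z, |L z| ≤ ‖z‖) :
    ∃ C : ℝ, 0 ≤ C ∧ IsParabolicKernel d j R C
      (fun t z => a * L (lksOsc d q t ((2 * Real.pi)⁻¹ • z))) := by
  obtain ⟨C, hC, H⟩ := norm_lksOsc_le d j hq hj R (d + 1)
  refine ⟨|a| * (C * (2 * Real.pi) ^ (d + 1)), by positivity, ?_, ?_⟩
  · refine continuousOn_const.mul (L.continuous.comp_continuousOn ?_)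
    refine (continuousOn_lksOsc d j hq hj).comp
      (f := fun b : ℝ × KSB.Rd d => (b.1, (2 * Real.pi)⁻¹ • b.2)) (by fun_prop) ?_
    exact fun b hb => ⟨hb.1, trivial⟩
  · intro c hc hcR z
    have h := H c hc hcR ((2 * Real.pi)⁻¹ • z)
    have hpi : 1 ≤ 2 * Real.pi := by linarith [Real.two_le_pi]
    have h3 : (1 + ‖(2 * Real.pi)⁻¹ • z‖ / c) ^ (-((d + 1 : ℕ) : ℝ))
        ≤ (2 * Real.pi) ^ (d + 1) * (1 + ‖z‖ / c) ^ (-((d + 1 : ℕ) : ℝ)) := by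
      rw [Real.rpow_neg (by positivity), Real.rpow_neg (by positivity), Real.rpow_natCast,
        Real.rpow_natCast, ← div_eq_mul_inv, le_div_iff₀ (by positivity),
        inv_mul_le_iff₀ (by positivity), ← mul_pow]
      gcongr
      rw [norm_smul, Real.norm_of_nonneg (by positivity)]
      have : (1 + (2 * Real.pi)⁻¹ * ‖z‖ / c) * (2 * Real.pi) = 2 * Real.pi + ‖z‖ / c := by
        field_simp
      rw [this]
      gcongr
    rw [abs_mul]
    calc _ ≤ |a| * (C * (c ^ (d + j))⁻¹ * ((2 * Real.pi) ^ (d + 1) *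
          (1 + ‖z‖ / c) ^ (-((d + 1 : ℕ) : ℝ)))) := by
          gcongr
          refine (hL _).trans (h.trans ?_)
          gcongr
      _ = _ := by ring

theorem exists_isParabolicKernel_lksKernel (d : ℕ) (R : ℝ) :
    ∃ C : ℝ, 0 ≤ C ∧ ∃ κ, IsParabolicKernel d 0 R C κ ∧
      ∀ t, 0 < t → ∀ x y, KSB.lksKernel d t x y = κ t (x - y) := by
  obtain ⟨C, hC, h⟩ := exists_isParabolicKernel_of_lksOsc d 0 (q := fun _ => 1) (.const 1)
    (one_homogeneous d) R ((2 * Real.pi) ^ d)⁻¹ Complex.reCLM Complex.abs_re_le_norm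
  exact ⟨C, hC, _, h, fun t ht x y => lksKernel_eq_re_lksOsc d ht x y⟩

theorem exists_isParabolicKernel_lksKernelDeriv (d : ℕ) (R : ℝ) (ℓ : Fin d) :
    ∃ C : ℝ, 0 ≤ C ∧ ∃ κ, IsParabolicKernel d 1 R C κ ∧
      ∀ t, 0 < t → ∀ x y, KSB.lksKernelDeriv d ℓ t x y = κ t (x - y) := by
  obtain ⟨C, hC, h⟩ := exists_isParabolicKernel_of_lksOsc d 1 (coord_hasTemperateGrowth d ℓ)
    (coord_homogeneous d ℓ) R (-((2 * Real.pi) ^ d)⁻¹) Complex.imCLM Complex.abs_im_le_norm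
  exact ⟨C, hC, _, h, fun t ht x y => lksKernelDeriv_eq_im_lksOsc d ℓ ht x y⟩

/-! ### Hölder, Minkowski and Young inequalities for nonnegative integrals. -/

/-- Hölder applied to fg = f^{1-1/s} (f g^s)^{1/s}, that is, Jensen for the measure f dμ without
normalisation. -/
theorem rpow_lintegral_mul_le {α : Type*} [MeasurableSpace α] {μ : Measure α} {f g : α → ℝ≥0∞}
    (hf : AEMeasurable f μ) (hg : AEMeasurable g μ) {s : ℝ} (hs : 1 ≤ s) :
    (∫⁻ a, f a * g a ∂μ) ^ s ≤ (∫⁻ a, f a ∂μ) ^ (s - 1) * ∫⁻ a, f a * g a ^ s ∂μ := by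
  have hs0 : 0 < s := by linarith
  have hs1 : 0 ≤ 1 - s⁻¹ := sub_nonneg.2 (inv_le_one_of_one_le₀ hs)
  have h := ENNReal.lintegral_mul_norm_pow_le (μ := μ) (f := f) (g := fun a => f a * g a ^ s)
    hf (hf.mul (hg.pow_const s)) hs1 (inv_nonneg.2 hs0.le) (by ring)
  have e : ∀ a, f a ^ (1 - s⁻¹) * (f a * g a ^ s) ^ s⁻¹ = f a * g a := by
    intro a
    rw [ENNReal.mul_rpow_of_nonneg _ _ (inv_nonneg.2 hs0.le), ENNReal.rpow_rpow_inv hs0.ne',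
      ← mul_assoc, ← ENNReal.rpow_add_of_nonneg _ _ hs1 (inv_nonneg.2 hs0.le)]
    simp
  simp only [e] at h
  calc _ ≤ ((∫⁻ a, f a ∂μ) ^ (1 - s⁻¹) * (∫⁻ a, f a * g a ^ s ∂μ) ^ s⁻¹) ^ s := by gcongr
    _ = _ := by
      rw [ENNReal.mul_rpow_of_nonneg _ _ hs0.le, ENNReal.rpow_inv_rpow hs0.ne',
        ← ENNReal.rpow_mul, sub_mul, inv_mul_cancel₀ hs0.ne', one_mul]

theorem eLpNorm_ofReal_eq {α ε : Type*} [MeasurableSpace α] [ENorm ε] {μ : Measure α}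
    (f : α → ε) {s : ℝ} (hs : 0 < s) :
    eLpNorm f (ENNReal.ofReal s) μ = (∫⁻ a, ‖f a‖ₑ ^ s ∂μ) ^ s⁻¹ := by
  rw [eLpNorm_eq_lintegral_rpow_enorm_toReal (by simpa using hs) ENNReal.ofReal_ne_top,
    ENNReal.toReal_ofReal hs.le, one_div]

/-- A form of Minkowski's integral inequality. -/
theorem eLpNorm_lintegral_le {α β : Type*} [MeasurableSpace α] [MeasurableSpace β]
    {μ : Measure α} {ν : Measure β} [SFinite μ] [SFinite ν] {f : β → α → ℝ≥0∞}
    (hf : Measurable (Function.uncurry f)) {w : β → ℝ≥0∞} (hw : Measurable w)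
    (hw0 : ∀ᵐ r ∂ν, w r ≠ 0) (hwt : ∀ r, w r ≠ ∞) {s : ℝ} (hs : 1 ≤ s) {N : ℝ≥0∞}
    (hfw : ∀ᵐ r ∂ν, eLpNorm (f r) (ENNReal.ofReal s) μ ≤ N * w r) :
    eLpNorm (fun x => ∫⁻ r, f r x ∂ν) (ENNReal.ofReal s) μ ≤ N * ∫⁻ r, w r ∂ν := by
  have hs0 : 0 < s := by linarith
  rw [eLpNorm_ofReal_eq _ hs0]
  simp only [enorm_eq_self]
  rw [ENNReal.rpow_inv_le_iff hs0]
  have hfr : ∀ x, Measurable fun r => f r x := fun x => hf.of_uncurry_right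
  -- Hölder against w dr followed by Tonelli needs only the majorant w to be measurable, not the
  -- norms of the slices.
  have h1 : ∀ x, (∫⁻ r, f r x ∂ν) ^ s
      ≤ (∫⁻ r, w r ∂ν) ^ (s - 1) * ∫⁻ r, w r * (f r x / w r) ^ s ∂ν := by
    intro x
    have e : ∫⁻ r, f r x ∂ν = ∫⁻ r, w r * (f r x / w r) ∂ν := by
      refine lintegral_congr_ae ?_
      filter_upwards [hw0] with r hr
      rw [ENNReal.mul_div_cancel hr (hwt r)]
    rw [e]
    exact rpow_lintegral_mul_le hw.aemeasurable ((hfr x).div hw).aemeasurable hs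
  have hm : Measurable fun z : α × β => w z.2 * (f z.2 z.1 / w z.2) ^ s := by
    have : Measurable fun z : α × β => f z.2 z.1 := hf.comp measurable_swap
    fun_prop
  calc _ ≤ ∫⁻ x, (∫⁻ r, w r ∂ν) ^ (s - 1) * ∫⁻ r, w r * (f r x / w r) ^ s ∂ν ∂μ :=
        lintegral_mono h1
    _ = (∫⁻ r, w r ∂ν) ^ (s - 1) * ∫⁻ x, ∫⁻ r, w r * (f r x / w r) ^ s ∂ν ∂μ :=
        lintegral_const_mul _ hm.lintegral_prod_right'
    _ = (∫⁻ r, w r ∂ν) ^ (s - 1) * ∫⁻ r, ∫⁻ x, w r * (f r x / w r) ^ s ∂μ ∂ν := by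
        rw [lintegral_lintegral_swap hm.aemeasurable]
    _ ≤ (∫⁻ r, w r ∂ν) ^ (s - 1) * ∫⁻ r, N ^ s * w r ∂ν := by
        refine mul_le_mul' le_rfl (lintegral_mono_ae ?_)
        filter_upwards [hw0, hfw] with r hr hr'
        rw [eLpNorm_ofReal_eq _ hs0, ENNReal.rpow_inv_le_iff hs0] at hr'
        simp only [enorm_eq_self] at hr'
        have hfx : Measurable fun x => f r x := hf.of_uncurry_left
        have e : ∀ x, w r * (f r x / w r) ^ s = w r * (w r ^ s)⁻¹ * f r x ^ s := by
          intro x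
          rw [ENNReal.div_rpow_of_nonneg _ _ hs0.le, div_eq_mul_inv]; ring
        simp_rw [e]
        rw [lintegral_const_mul _ (hfx.pow_const s)]
        calc _ ≤ w r * (w r ^ s)⁻¹ * (N * w r) ^ s := by gcongr
          _ = N ^ s * w r * ((w r ^ s)⁻¹ * w r ^ s) := by
            rw [ENNReal.mul_rpow_of_nonneg _ _ hs0.le]; ring
          _ = N ^ s * w r := by
            rw [ENNReal.inv_mul_cancel, mul_one]
            · simp [hr, hs0, hwt r]
            · simp [hs0.le, hwt r]
    _ = (N * ∫⁻ r, w r ∂ν) ^ s := by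
        rw [lintegral_const_mul _ hw, ENNReal.mul_rpow_of_nonneg _ _ hs0.le, mul_left_comm]
        congr 1
        nth_rw 2 [← ENNReal.rpow_one (∫⁻ r, w r ∂ν)]
        rw [← ENNReal.rpow_add_of_nonneg _ _ (by linarith) zero_le_one, sub_add_cancel]

section Young

variable {d : ℕ} {φ g : KSB.Rd d → ℝ≥0∞}

theorem rpow_lintegral_sub_mul_le (hφ : Measurable φ) (hg : Measurable g) {s : ℝ} (hs : 1 ≤ s)
    (x : KSB.Rd d) :
    (∫⁻ y, φ (x - y) * g y) ^ s ≤ (∫⁻ z, φ z) ^ (s - 1) * ∫⁻ y, φ (x - y) * g y ^ s := by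
  have := rpow_lintegral_mul_le (μ := volume) (f := fun y => φ (x - y)) (g := g)
    (hφ.comp (by fun_prop)).aemeasurable hg.aemeasurable hs
  rwa [lintegral_sub_left_eq_self φ x] at this

/-- The bound φ ≤ 1 removes φ from the last Hölder factor, which leaves a bound uniform in x. -/
theorem lintegral_sub_mul_le_eLpNorm (hφ : Measurable φ) (hφ1 : ∀ z, φ z ≤ 1) (hg : Measurable g)
    {s : ℝ} (hs : 1 ≤ s) (x : KSB.Rd d) :
    ∫⁻ y, φ (x - y) * g y
      ≤ (∫⁻ z, φ z) ^ (1 - s⁻¹) * eLpNorm g (ENNReal.ofReal s) volume := by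
  have hs0 : 0 < s := by linarith
  rw [eLpNorm_ofReal_eq _ hs0]
  simp only [enorm_eq_self]
  have h := rpow_lintegral_sub_mul_le hφ hg hs x
  have h2 : ∫⁻ y, φ (x - y) * g y ^ s ≤ ∫⁻ y, g y ^ s :=
    lintegral_mono fun y => mul_le_of_le_one_left' (hφ1 _)
  rw [← ENNReal.rpow_le_rpow_iff hs0, ENNReal.mul_rpow_of_nonneg _ _ hs0.le,
    ENNReal.rpow_inv_rpow hs0.ne', ← ENNReal.rpow_mul, sub_mul, inv_mul_cancel₀ hs0.ne', one_mul]
  exact h.trans (by gcongr)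

theorem lintegral_lintegral_sub_mul (hφ : Measurable φ) (hg : Measurable g) :
    ∫⁻ x, ∫⁻ y, φ (x - y) * g y = (∫⁻ z, φ z) * ∫⁻ y, g y := by
  have hm : Measurable fun z : KSB.Rd d × KSB.Rd d => φ (z.1 - z.2) * g z.2 :=
    (hφ.comp (by fun_prop)).mul (hg.comp measurable_snd)
  rw [lintegral_lintegral_swap hm.aemeasurable]
  have : ∀ y, ∫⁻ x, φ (x - y) * g y = (∫⁻ z, φ z) * g y := fun y => by
    have hφy : Measurable fun x => φ (x - y) := hφ.comp (by fun_prop)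
    rw [lintegral_mul_const _ hφy, lintegral_sub_right_eq_self φ y]
  simp_rw [this]
  rw [lintegral_const_mul _ hg]

theorem eLpNorm_lintegral_sub_mul_le (hφ : Measurable φ) (hg : Measurable g) {s : ℝ}
    (hs : 1 ≤ s) :
    eLpNorm (fun x => ∫⁻ y, φ (x - y) * g y) (ENNReal.ofReal s) volume
      ≤ (∫⁻ z, φ z) * eLpNorm g (ENNReal.ofReal s) volume := by
  have hs0 : 0 < s := by linarith
  rw [eLpNorm_ofReal_eq _ hs0, eLpNorm_ofReal_eq _ hs0]
  simp only [enorm_eq_self]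
  rw [ENNReal.rpow_inv_le_iff hs0, ENNReal.mul_rpow_of_nonneg _ _ hs0.le,
    ENNReal.rpow_inv_rpow hs0.ne']
  have hm : Measurable fun z : KSB.Rd d × KSB.Rd d => φ (z.1 - z.2) * g z.2 ^ s :=
    (hφ.comp (by fun_prop)).mul ((hg.pow_const s).comp measurable_snd)
  calc _ ≤ ∫⁻ x, (∫⁻ z, φ z) ^ (s - 1) * ∫⁻ y, φ (x - y) * g y ^ s :=
        lintegral_mono fun x => rpow_lintegral_sub_mul_le hφ hg hs x
    _ = (∫⁻ z, φ z) ^ (s - 1) * ((∫⁻ z, φ z) * ∫⁻ y, g y ^ s) := by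
        rw [lintegral_const_mul _ hm.lintegral_prod_right',
          lintegral_lintegral_sub_mul hφ (hg.pow_const s)]
    _ = _ := by
        rw [← mul_assoc]
        congr 1
        nth_rw 2 [← ENNReal.rpow_one (∫⁻ z, φ z)]
        rw [← ENNReal.rpow_add_of_nonneg _ _ (by linarith) zero_le_one, sub_add_cancel]

/-- The power 2s of the convolution is a product of two s-th powers: one is bounded uniformly in x
using φ ≤ 1, the other is integrated by Tonelli. -/
theorem eLpNorm_two_mul_lintegral_sub_mul_le (hφ : Measurable φ) (hφ1 : ∀ z, φ z ≤ 1)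
    (hg : Measurable g) {s : ℝ} (hs : 1 ≤ s) :
    eLpNorm (fun x => ∫⁻ y, φ (x - y) * g y) (ENNReal.ofReal (2 * s)) volume
      ≤ (∫⁻ z, φ z) ^ (1 - (2 * s)⁻¹) * eLpNorm g (ENNReal.ofReal s) volume := by
  have hs0 : 0 < s := by linarith
  have h2s0 : 0 < 2 * s := by linarith
  set m := ∫⁻ z, φ z with hm
  rw [eLpNorm_ofReal_eq _ h2s0, ENNReal.rpow_inv_le_iff h2s0,
    ENNReal.mul_rpow_of_nonneg _ _ h2s0.le, ← ENNReal.rpow_mul, sub_mul,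
    inv_mul_cancel₀ h2s0.ne', one_mul]
  simp only [enorm_eq_self]
  have hme : Measurable fun z : KSB.Rd d × KSB.Rd d => φ (z.1 - z.2) * g z.2 ^ s :=
    (hφ.comp (by fun_prop)).mul ((hg.pow_const s).comp measurable_snd)
  set A := eLpNorm g (ENNReal.ofReal s) volume with hA
  have hAs : ∫⁻ y, g y ^ s = A ^ s := by
    rw [hA, eLpNorm_ofReal_eq _ hs0, ENNReal.rpow_inv_rpow hs0.ne']
    simp only [enorm_eq_self]
  have pt : ∀ x, (∫⁻ y, φ (x - y) * g y) ^ (2 * s)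
      ≤ m ^ (s - 1) * A ^ s * m ^ (s - 1) * ∫⁻ y, φ (x - y) * g y ^ s := by
    intro x
    have h1 := rpow_lintegral_sub_mul_le hφ hg hs x
    have h2 : ∫⁻ y, φ (x - y) * g y ^ s ≤ A ^ s := by
      rw [← hAs]; exact lintegral_mono fun y => mul_le_of_le_one_left' (hφ1 _)
    calc _ = (∫⁻ y, φ (x - y) * g y) ^ s * (∫⁻ y, φ (x - y) * g y) ^ s := by
          rw [← ENNReal.rpow_add_of_nonneg _ _ hs0.le hs0.le, two_mul]
      _ ≤ (m ^ (s - 1) * A ^ s) * (m ^ (s - 1) * ∫⁻ y, φ (x - y) * g y ^ s) :=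
          mul_le_mul' (h1.trans (by gcongr)) h1
      _ = _ := by ring
  calc _ ≤ ∫⁻ x, m ^ (s - 1) * A ^ s * m ^ (s - 1) * ∫⁻ y, φ (x - y) * g y ^ s :=
        lintegral_mono pt
    _ = m ^ (s - 1) * A ^ s * m ^ (s - 1) * (m * A ^ s) := by
        rw [lintegral_const_mul _ hme.lintegral_prod_right',
          lintegral_lintegral_sub_mul hφ (hg.pow_const s), hAs]
    _ = (m ^ (s - 1) * m ^ (s - 1) * m ^ (1 : ℝ)) * (A ^ s * A ^ s) := by
        rw [ENNReal.rpow_one]; ring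
    _ = _ := by
        rw [← ENNReal.rpow_add_of_nonneg _ _ (by linarith) (by linarith),
          ← ENNReal.rpow_add_of_nonneg _ _ (by linarith) (by linarith),
          ← ENNReal.rpow_add_of_nonneg _ _ (by linarith) (by linarith)]
        congr 2 <;> ring

end Young

/-! ### Convolution with a parabolic kernel. -/

/-- The weight `(1 + |z|/c)^{-(d+1)}`. -/
noncomputable def decayWeight (d : ℕ) (c : ℝ) (z : KSB.Rd d) : ℝ≥0∞ :=
  ENNReal.ofReal ((1 + ‖z‖ / c) ^ (-((d + 1 : ℕ) : ℝ)))

theorem measurable_decayWeight (d : ℕ) (c : ℝ) : Measurable (decayWeight d c) := by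
  unfold decayWeight; fun_prop

theorem decayWeight_le_one (d : ℕ) {c : ℝ} (hc : 0 < c) (z : KSB.Rd d) :
    decayWeight d c z ≤ 1 := by
  rw [decayWeight, ENNReal.ofReal_le_one]
  exact Real.rpow_le_one_of_one_le_of_nonpos (by have := norm_nonneg z; simp; positivity)
    (neg_nonpos.2 (Nat.cast_nonneg _))

/-- The mass of the unit decay weight. -/
noncomputable def decayMass (d : ℕ) : ℝ := ∫ z : KSB.Rd d, (1 + ‖z‖) ^ (-((d + 1 : ℕ) : ℝ))

theorem decayMass_nonneg (d : ℕ) : 0 ≤ decayMass d := integral_nonneg fun v => by positivity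

theorem lintegral_decayWeight (d : ℕ) {c : ℝ} (hc : 0 < c) :
    ∫⁻ z, decayWeight d c z = ENNReal.ofReal (c ^ d * decayMass d) := by
  have hint : Integrable (fun v : KSB.Rd d => (1 + ‖v‖) ^ (-((d + 1 : ℕ) : ℝ))) :=
    integrable_one_add_norm (by simp)
  have e : ∀ z : KSB.Rd d, (1 + ‖z‖ / c) ^ (-((d + 1 : ℕ) : ℝ))
      = (fun v : KSB.Rd d => (1 + ‖v‖) ^ (-((d + 1 : ℕ) : ℝ))) (c⁻¹ • z) := by
    intro z
    simp only [norm_smul, norm_inv, Real.norm_of_nonneg hc.le, inv_mul_eq_div]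
  simp only [decayWeight, e]
  rw [← ofReal_integral_eq_lintegral_ofReal (hint.comp_smul (inv_ne_zero hc.ne'))
    (Filter.Eventually.of_forall fun v => by positivity),
    Measure.integral_comp_smul_of_nonneg volume
      (fun v : KSB.Rd d => (1 + ‖v‖) ^ (-((d + 1 : ℕ) : ℝ))) c⁻¹ (hR := (inv_pos.2 hc).le)]
  simp [decayMass]

/-- The convolution `∫ κ t (x - y) v(y) dy`. -/
noncomputable def kernelConv {d : ℕ} (κ : ℝ → KSB.Rd d → ℝ) (t : ℝ) (v : KSB.Rd d → ℝ)
    (x : KSB.Rd d) : ℝ :=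
  ∫ y, κ t (x - y) * v y

theorem eLpNorm_le_const_mul_eLpNorm {α : Type*} [MeasurableSpace α] {μ : Measure α}
    {f : α → ℝ} {g : α → ℝ≥0∞} {a : ℝ≥0∞} (ha : a ≠ ∞) {s : ℝ} (hs : 0 < s)
    (h : ∀ x, ‖f x‖ₑ ≤ a * g x) :
    eLpNorm f (ENNReal.ofReal s) μ ≤ a * eLpNorm g (ENNReal.ofReal s) μ := by
  rw [eLpNorm_ofReal_eq _ hs, eLpNorm_ofReal_eq _ hs, ENNReal.rpow_inv_le_iff hs,
    ENNReal.mul_rpow_of_nonneg _ _ hs.le, ENNReal.rpow_inv_rpow hs.ne',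
    ← lintegral_const_mul' _ _ (by simp [ha, hs.le])]
  refine lintegral_mono fun x => ?_
  rw [← ENNReal.mul_rpow_of_nonneg _ _ hs.le, enorm_eq_self]
  gcongr
  exact h x

theorem integrable_of_abs_le_decayWeight {d : ℕ} {c σ A : ℝ} (hc : 0 < c) (hσ : 1 ≤ σ)
    {v f : KSB.Rd d → ℝ} (hv : Measurable v) (hvL : MemLp v (ENNReal.ofReal σ) volume)
    (hf : AEStronglyMeasurable f volume) (x : KSB.Rd d)
    (h : ∀ y, ‖f y‖ₑ ≤ ENNReal.ofReal A * (decayWeight d c (x - y) * ‖v y‖ₑ)) :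
    Integrable f := by
  refine ⟨hf, ?_⟩
  rw [hasFiniteIntegral_iff_enorm]
  have hσ0 : 0 < σ := by linarith
  have h1 := lintegral_sub_mul_le_eLpNorm (measurable_decayWeight d c)
    (decayWeight_le_one d hc) hv.enorm hσ x
  rw [eLpNorm_enorm, lintegral_decayWeight d hc] at h1
  calc _ ≤ ∫⁻ y, ENNReal.ofReal A * (decayWeight d c (x - y) * ‖v y‖ₑ) := lintegral_mono h
    _ = ENNReal.ofReal A * ∫⁻ y, decayWeight d c (x - y) * ‖v y‖ₑ :=
        lintegral_const_mul' _ _ ENNReal.ofReal_ne_top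
    _ < ∞ := ENNReal.mul_lt_top ENNReal.ofReal_lt_top (h1.trans_lt (ENNReal.mul_lt_top
        (ENNReal.rpow_lt_top_of_nonneg (sub_nonneg.2 (inv_le_one_of_one_le₀ hσ))
          ENNReal.ofReal_ne_top) hvL.2))

namespace IsParabolicKernel

variable {d j : ℕ} {R C : ℝ} {κ : ℝ → KSB.Rd d → ℝ}

theorem continuous_of_pos (hκ : IsParabolicKernel d j R C κ) {t : ℝ} (ht : 0 < t) :
    Continuous (κ t) := by
  have := hκ.continuousOn.comp_continuous (f := fun z : KSB.Rd d => (t, z)) (by fun_prop)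
    (fun z => ⟨ht, trivial⟩)
  exact this

theorem enorm_mul_le (hκ : IsParabolicKernel d j R C κ) {c : ℝ} (hc : 0 < c) (hcR : c ≤ R)
    (v : KSB.Rd d → ℝ) (x y : KSB.Rd d) :
    ‖κ (c ^ 4) (x - y) * v y‖ₑ
      ≤ ENNReal.ofReal (C * (c ^ (d + j))⁻¹) * (decayWeight d c (x - y) * ‖v y‖ₑ) := by
  rw [enorm_mul, ← mul_assoc]
  gcongr
  rw [decayWeight, ← ENNReal.ofReal_mul' (by positivity), Real.enorm_eq_ofReal_abs]
  exact ENNReal.ofReal_le_ofReal (hκ.bound c hc hcR _)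

theorem integrable_mul (hκ : IsParabolicKernel d j R C κ) {t : ℝ} (ht : 0 < t) (htR : t ≤ R ^ 4)
    (hR : 0 < R) {σ : ℝ} (hσ : 1 ≤ σ) {v : KSB.Rd d → ℝ} (hv : Measurable v)
    (hvL : MemLp v (ENNReal.ofReal σ) volume) (x : KSB.Rd d) :
    Integrable fun y => κ t (x - y) * v y := by
  obtain ⟨c, hc, rfl⟩ := exists_pow_four ht
  have hcR : c ≤ R := le_of_pow_le_pow_left₀ (by norm_num) hR.le htR
  refine integrable_of_abs_le_decayWeight hc hσ hv hvL ?_ x (hκ.enorm_mul_le hc hcR v x)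
  have := hκ.continuous_of_pos ht
  exact ((by fun_prop : Continuous fun y => κ (c ^ 4) (x - y)).measurable.mul
    hv).aestronglyMeasurable

theorem enorm_kernelConv_le (hκ : IsParabolicKernel d j R C κ) {c : ℝ} (hc : 0 < c)
    (hcR : c ≤ R) (v : KSB.Rd d → ℝ) (x : KSB.Rd d) :
    ‖kernelConv κ (c ^ 4) v x‖ₑ ≤ ENNReal.ofReal (C * (c ^ (d + j))⁻¹) *
      ∫⁻ y, decayWeight d c (x - y) * ‖v y‖ₑ := by
  refine (enorm_integral_le_lintegral_enorm _).trans ?_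
  rw [← lintegral_const_mul' _ _ ENNReal.ofReal_ne_top]
  exact lintegral_mono (hκ.enorm_mul_le hc hcR v x)

theorem eLpNorm_kernelConv_le (hκ : IsParabolicKernel d j R C κ) {c : ℝ} (hc : 0 < c)
    (hcR : c ≤ R) {σ : ℝ} (hσ : 1 ≤ σ) {v : KSB.Rd d → ℝ} (hv : Measurable v) :
    eLpNorm (kernelConv κ (c ^ 4) v) (ENNReal.ofReal σ) volume
      ≤ ENNReal.ofReal (C * decayMass d * (c ^ j)⁻¹) * eLpNorm v (ENNReal.ofReal σ) volume := by
  refine (eLpNorm_le_const_mul_eLpNorm ENNReal.ofReal_ne_top (by linarith)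
    (hκ.enorm_kernelConv_le hc hcR v)).trans ?_
  have h := eLpNorm_lintegral_sub_mul_le (measurable_decayWeight d c) hv.enorm hσ
  rw [eLpNorm_enorm, lintegral_decayWeight d hc] at h
  refine (mul_le_mul' le_rfl h).trans ?_
  have := decayMass_nonneg d
  rw [← mul_assoc, ← ENNReal.ofReal_mul' (by positivity)]
  refine mul_le_mul' (ENNReal.ofReal_le_ofReal (le_of_eq ?_)) le_rfl
  rw [pow_add]
  field_simp

theorem eLpNorm_two_mul_kernelConv_le (hκ : IsParabolicKernel d j R C κ) {c : ℝ} (hc : 0 < c)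
    (hcR : c ≤ R) {σ : ℝ} (hσ : 1 ≤ σ) {v : KSB.Rd d → ℝ} (hv : Measurable v) :
    eLpNorm (kernelConv κ (c ^ 4) v) (ENNReal.ofReal (2 * σ)) volume
      ≤ ENNReal.ofReal (C * decayMass d ^ (1 - (2 * σ)⁻¹) * c ^ (-(j + d / (2 * σ)) : ℝ)) *
        eLpNorm v (ENNReal.ofReal σ) volume := by
  refine (eLpNorm_le_const_mul_eLpNorm ENNReal.ofReal_ne_top (by linarith)
    (hκ.enorm_kernelConv_le hc hcR v)).trans ?_
  have h := eLpNorm_two_mul_lintegral_sub_mul_le (measurable_decayWeight d c)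
    (decayWeight_le_one d hc) hv.enorm hσ
  rw [eLpNorm_enorm, lintegral_decayWeight d hc] at h
  refine (mul_le_mul' le_rfl h).trans ?_
  have hm := decayMass_nonneg d
  have h2 : 0 ≤ 1 - (2 * σ)⁻¹ := sub_nonneg.2 (inv_le_one_of_one_le₀ (by linarith))
  rw [← mul_assoc, ENNReal.ofReal_rpow_of_nonneg (by positivity) h2,
    ← ENNReal.ofReal_mul' (by positivity)]
  refine mul_le_mul' (ENNReal.ofReal_le_ofReal (le_of_eq ?_)) le_rfl
  rw [Real.mul_rpow (by positivity) hm, ← Real.rpow_natCast, ← Real.rpow_natCast,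
    ← Real.rpow_neg hc.le, ← Real.rpow_mul hc.le]
  have : C * c ^ (-((d + j : ℕ) : ℝ)) * (c ^ (d * (1 - (2 * σ)⁻¹)) * decayMass d ^ (1 - (2 * σ)⁻¹))
      = C * decayMass d ^ (1 - (2 * σ)⁻¹) *
        (c ^ (-((d + j : ℕ) : ℝ)) * c ^ (d * (1 - (2 * σ)⁻¹))) := by ring
  rw [this, ← Real.rpow_add hc]
  congr 2
  push_cast
  ring

theorem continuousAt_kernelConv (hκ : IsParabolicKernel d j R C κ) (hC : 0 ≤ C) {σ : ℝ}
    (hσ : 1 ≤ σ) {v : KSB.Rd d → ℝ} (hv : Measurable v)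
    (hvL : MemLp v (ENNReal.ofReal σ) volume) {c₀ : ℝ} (hc₀ : 0 < c₀) (hc₀R : c₀ < R)
    (x₀ : KSB.Rd d) :
    ContinuousAt (fun a : ℝ × KSB.Rd d => kernelConv κ a.1 v a.2) (c₀ ^ 4, x₀) := by
  have hR : 0 < R := hc₀.trans hc₀R
  -- For c between c₀/2 and 2c₀ and a centre within c₀ of x₀, the weights are comparable up to
  -- 2^{d+1}, so the weight at (c₀, x₀) dominates.
  set A : ℝ := C * ((c₀ / 2) ^ (d + j))⁻¹ * 2 ^ (d + 1) with hA
  have hev : ∀ᶠ a : ℝ × KSB.Rd d in nhds (c₀ ^ 4, x₀),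
      (c₀ / 2) ^ 4 < a.1 ∧ a.1 < (2 * c₀) ^ 4 ∧ a.1 < R ^ 4 ∧ ‖x₀ - a.2‖ < c₀ := by
    have h1 : ContinuousAt (fun a : ℝ × KSB.Rd d => a.1) (c₀ ^ 4, x₀) := continuousAt_fst
    have h2 : ContinuousAt (fun a : ℝ × KSB.Rd d => ‖x₀ - a.2‖) (c₀ ^ 4, x₀) := by fun_prop
    refine (h1.eventually (lt_mem_nhds ?_)).and ((h1.eventually (gt_mem_nhds ?_)).and
      ((h1.eventually (gt_mem_nhds ?_)).and (h2.eventually (gt_mem_nhds ?_))))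
    · exact pow_lt_pow_left₀ (by linarith) (by positivity) (by norm_num)
    · exact pow_lt_pow_left₀ (by linarith) (by positivity) (by norm_num)
    · exact pow_lt_pow_left₀ hc₀R (by positivity) (by norm_num)
    · simpa using hc₀
  refine continuousAt_of_dominated
    (bound := fun y => A * ((1 + ‖x₀ - y‖ / c₀) ^ (-((d + 1 : ℕ) : ℝ)) * |v y|)) ?_ ?_ ?_ ?_
  · filter_upwards [hev] with a ha
    have := hκ.continuous_of_pos (t := a.1) (lt_trans (by positivity) ha.1)
    exact ((by fun_prop : Continuous fun y => κ a.1 (a.2 - y)).measurable.mul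
      hv).aestronglyMeasurable
  · filter_upwards [hev] with a ha
    refine Filter.Eventually.of_forall fun y => ?_
    obtain ⟨c, hc, hca⟩ := exists_pow_four (lt_trans (by positivity) ha.1)
    rw [← hca] at ha
    obtain ⟨h1, h2, h3, h4⟩ := ha
    have h1 := lt_of_pow_lt_pow_left₀ 4 hc.le h1
    have h2 := lt_of_pow_lt_pow_left₀ 4 (by positivity) h2
    have h3 := lt_of_pow_lt_pow_left₀ 4 hR.le h3
    rw [← hca, norm_mul, Real.norm_eq_abs, Real.norm_eq_abs, ← mul_assoc]
    gcongr
    refine (hκ.bound c hc h3.le _).trans ?_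
    have e1 : (1 + ‖a.2 - y‖ / c) ^ (-((d + 1 : ℕ) : ℝ))
        ≤ 2 ^ (d + 1) * (1 + ‖x₀ - y‖ / c₀) ^ (-((d + 1 : ℕ) : ℝ)) := by
      rw [Real.rpow_neg (by positivity), Real.rpow_neg (by positivity), Real.rpow_natCast,
        Real.rpow_natCast, ← div_eq_mul_inv, le_div_iff₀ (by positivity),
        inv_mul_le_iff₀ (by positivity), ← mul_pow]
      gcongr
      have t1 : ‖x₀ - y‖ ≤ c₀ + ‖a.2 - y‖ := by
        have := norm_add_le (x₀ - a.2) (a.2 - y)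
        rw [sub_add_sub_cancel] at this
        linarith
      have t2 : ‖x₀ - y‖ / c₀ ≤ 1 + ‖a.2 - y‖ / c₀ := by
        rw [div_le_iff₀ hc₀, add_mul, div_mul_cancel₀ _ hc₀.ne']
        linarith
      have t3 : ‖a.2 - y‖ / c₀ ≤ 2 * (‖a.2 - y‖ / c) := by
        rw [← mul_div_assoc, div_le_div_iff₀ hc₀ hc]
        nlinarith [norm_nonneg (a.2 - y)]
      linarith
    calc _ ≤ C * ((c₀ / 2) ^ (d + j))⁻¹ *
          (2 ^ (d + 1) * (1 + ‖x₀ - y‖ / c₀) ^ (-((d + 1 : ℕ) : ℝ))) := by gcongr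
      _ = _ := by rw [hA]; ring
  · refine integrable_of_abs_le_decayWeight (A := A) hc₀ hσ hv hvL ?_ x₀ fun y => ?_
    · exact Measurable.aestronglyMeasurable (by fun_prop)
    · have hA0 : 0 ≤ A := by positivity
      rw [enorm_mul, Real.enorm_of_nonneg hA0, enorm_mul, decayWeight,
        Real.enorm_of_nonneg (by positivity), Real.enorm_eq_ofReal_abs (|v y|), abs_abs,
        ← Real.enorm_eq_ofReal_abs]
  · refine Filter.Eventually.of_forall fun y => ?_
    have hpos : (0 : ℝ) < c₀ ^ 4 := by positivity
    have h1 : ContinuousAt (fun a : ℝ × KSB.Rd d => κ a.1 a.2) (c₀ ^ 4, x₀ - y) :=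
      hκ.continuousOn.continuousAt ((isOpen_Ioi.prod isOpen_univ).mem_nhds ⟨hpos, trivial⟩)
    refine ContinuousAt.mul ?_ continuousAt_const
    exact ContinuousAt.comp (f := fun a : ℝ × KSB.Rd d => (a.1, a.2 - y))
      (g := fun a : ℝ × KSB.Rd d => κ a.1 a.2) h1 (by fun_prop)

theorem kernelConv_sub (hκ : IsParabolicKernel d j R C κ) {t : ℝ} (ht : 0 < t)
    (htR : t ≤ R ^ 4) (hR : 0 < R) {σ : ℝ} (hσ : 1 ≤ σ) {v w : KSB.Rd d → ℝ} (hv : Measurable v)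
    (hw : Measurable w) (hvL : MemLp v (ENNReal.ofReal σ) volume)
    (hwL : MemLp w (ENNReal.ofReal σ) volume) (x : KSB.Rd d) :
    kernelConv κ t (v - w) x = kernelConv κ t v x - kernelConv κ t w x := by
  unfold kernelConv
  rw [← integral_sub (hκ.integrable_mul ht htR hR hσ hv hvL x)
    (hκ.integrable_mul ht htR hR hσ hw hwL x)]
  simp only [Pi.sub_apply, mul_sub]

end IsParabolicKernel

/-! ### Continuity, measurability and integrability of Duhamel integrands. -/

/-- A family of measurable functions in `L^σ` whose classes depend continuously on the time
in `(0,t)`. -/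
structure IsLpCurve (d : ℕ) (σ t : ℝ) (V : ℝ → KSB.Rd d → ℝ) : Prop where
  measurable : ∀ r, Measurable (V r)
  memLp : ∀ r, MemLp (V r) (ENNReal.ofReal σ) volume
  tendsto : ∀ r₀ ∈ Ioo 0 t, Filter.Tendsto
    (fun r => eLpNorm (V r - V r₀) (ENNReal.ofReal σ) volume) (nhds r₀) (nhds 0)

namespace IsParabolicKernel

variable {d j : ℕ} {R C : ℝ} {κ : ℝ → KSB.Rd d → ℝ}

/-- An L^σ to L^∞ bound, uniform while c stays away from 0; it turns L^σ continuity of a curve into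
pointwise continuity of its convolution. -/
theorem enorm_kernelConv_le_eLpNorm (hκ : IsParabolicKernel d j R C κ) (hC : 0 ≤ C) {c₀ c : ℝ}
    (hc₀ : 0 < c₀) (hc : c₀ ≤ c) (hcR : c ≤ R) {σ : ℝ} (hσ : 1 ≤ σ) {v : KSB.Rd d → ℝ}
    (hv : Measurable v) (x : KSB.Rd d) :
    ‖kernelConv κ (c ^ 4) v x‖ₑ ≤ ENNReal.ofReal (C * (c₀ ^ (d + j))⁻¹) *
      ENNReal.ofReal (R ^ d * decayMass d) ^ (1 - σ⁻¹) *
      eLpNorm v (ENNReal.ofReal σ) volume := by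
  have hc0 : 0 < c := hc₀.trans_le hc
  refine (hκ.enorm_kernelConv_le hc0 hcR v x).trans ?_
  have h1 := lintegral_sub_mul_le_eLpNorm (measurable_decayWeight d c)
    (decayWeight_le_one d hc0) hv.enorm hσ x
  rw [eLpNorm_enorm, lintegral_decayWeight d hc0] at h1
  have h2 : 0 ≤ 1 - σ⁻¹ := sub_nonneg.2 (inv_le_one_of_one_le₀ hσ)
  have := decayMass_nonneg d
  refine (mul_le_mul' le_rfl h1).trans ?_
  rw [← mul_assoc]
  gcongr

/-- Joint continuity in time and space of the inner Duhamel integrand. -/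
theorem continuousOn_kernelConv (hκ : IsParabolicKernel d j R C κ) (hC : 0 ≤ C) (hR : 0 < R)
    {σ : ℝ} (hσ : 1 ≤ σ) {t : ℝ} (htR : t ≤ R ^ 4) {V : ℝ → KSB.Rd d → ℝ}
    (hV : IsLpCurve d σ t V) :
    ContinuousOn (fun a : ℝ × KSB.Rd d => kernelConv κ (t - a.1) (V a.1) a.2)
      (Ioo 0 t ×ˢ univ) := by
  rintro ⟨r₀, x₀⟩ ⟨hr₀, -⟩
  have hr₀ : r₀ ∈ Ioo 0 t := hr₀
  refine ContinuousAt.continuousWithinAt ?_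
  obtain ⟨c₀, hc₀, hc₀s⟩ := exists_pow_four (sub_pos.2 hr₀.2)
  have hc₀R : c₀ < R := lt_of_pow_lt_pow_left₀ 4 hR.le (by rw [hc₀s]; linarith [hr₀.1])
  have hfst : ContinuousAt (fun a : ℝ × KSB.Rd d => a.1) (r₀, x₀) := continuousAt_fst
  have hev : ∀ᶠ a : ℝ × KSB.Rd d in nhds (r₀, x₀), a.1 ∈ Ioo 0 t ∧ (c₀ / 2) ^ 4 < t - a.1 := by
    refine (hfst.eventually (isOpen_Ioo.mem_nhds hr₀)).and ?_
    have h : ContinuousAt (fun a : ℝ × KSB.Rd d => t - a.1) (r₀, x₀) := by fun_prop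
    refine h.eventually (lt_mem_nhds ?_)
    show (c₀ / 2) ^ 4 < t - r₀
    rw [← hc₀s]
    exact pow_lt_pow_left₀ (by linarith) (by positivity) (by norm_num)
  -- Write V(r) = V(r₀) + (V(r) - V(r₀)): the frozen part is continuous by domination, and the
  -- remainder tends to 0 by the uniform bound.
  have hmain : ContinuousAt (fun a : ℝ × KSB.Rd d => kernelConv κ (t - a.1) (V r₀) a.2)
      (r₀, x₀) := by
    have h1 := hκ.continuousAt_kernelConv hC hσ (hV.measurable r₀) (hV.memLp r₀) hc₀ hc₀R x₀
    rw [hc₀s] at h1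
    exact ContinuousAt.comp (f := fun a : ℝ × KSB.Rd d => (t - a.1, a.2))
      (g := fun a : ℝ × KSB.Rd d => kernelConv κ a.1 (V r₀) a.2) h1 (by fun_prop)
  have hrest : Filter.Tendsto
      (fun a : ℝ × KSB.Rd d => kernelConv κ (t - a.1) (V a.1 - V r₀) a.2)
      (nhds (r₀, x₀)) (nhds 0) := by
    rw [tendsto_iff_edist_tendsto_0]
    simp only [edist_zero_right]
    set K := ENNReal.ofReal (C * ((c₀ / 2) ^ (d + j))⁻¹) *
      ENNReal.ofReal (R ^ d * decayMass d) ^ (1 - σ⁻¹) with hK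
    have hKt : K ≠ ∞ := ENNReal.mul_ne_top ENNReal.ofReal_ne_top
      (ENNReal.rpow_ne_top_of_nonneg (sub_nonneg.2 (inv_le_one_of_one_le₀ hσ))
        ENNReal.ofReal_ne_top)
    have hlim : Filter.Tendsto (fun a : ℝ × KSB.Rd d =>
        K * eLpNorm (V a.1 - V r₀) (ENNReal.ofReal σ) volume) (nhds (r₀, x₀)) (nhds 0) := by
      have := ENNReal.Tendsto.const_mul (a := K) ((hV.tendsto r₀ hr₀).comp hfst) (Or.inr hKt)
      rwa [mul_zero] at this
    refine tendsto_of_tendsto_of_tendsto_of_le_of_le' tendsto_const_nhds hlim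
      (Filter.Eventually.of_forall fun _ => zero_le) ?_
    filter_upwards [hev] with a ha
    obtain ⟨c, hc, hcs⟩ := exists_pow_four (sub_pos.2 ha.1.2)
    have h1 : c₀ / 2 ≤ c := (lt_of_pow_lt_pow_left₀ 4 hc.le (by rw [hcs]; exact ha.2)).le
    have h2 : c ≤ R := le_of_pow_le_pow_left₀ four_ne_zero hR.le
      (by rw [hcs]; linarith [ha.1.1])
    rw [← hcs]
    exact hκ.enorm_kernelConv_le_eLpNorm hC (by positivity) h1 h2 hσ ((hV.measurable _).sub (hV.measurable _)) _
  have hsum := hrest.add hmain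
  rw [zero_add] at hsum
  refine Filter.Tendsto.congr' ?_ hsum
  filter_upwards [hev] with a ha
  rw [hκ.kernelConv_sub (sub_pos.2 ha.1.2) (by linarith [ha.1.1]) hR hσ (hV.measurable _) (hV.measurable _) (hV.memLp _)
    (hV.memLp _)]
  ring

/-- Estimate of the Duhamel integral in `L^s`, in terms of a weight that bounds its integrand. -/
theorem eLpNorm_lintegral_kernelConv_le (hκ : IsParabolicKernel d j R C κ) (hC : 0 ≤ C)
    (hR : 0 < R) {σ : ℝ} (hσ : 1 ≤ σ) {t : ℝ} (htR : t ≤ R ^ 4) {V : ℝ → KSB.Rd d → ℝ}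
    (hV : IsLpCurve d σ t V)
    {s : ℝ} (hs : 1 ≤ s) {w : ℝ → ℝ≥0∞} (hw : Measurable w) (hw0 : ∀ r ∈ Ioo 0 t, w r ≠ 0)
    (hwt : ∀ r, w r ≠ ∞) {N : ℝ≥0∞}
    (hN : ∀ r ∈ Ioo 0 t,
      eLpNorm (kernelConv κ (t - r) (V r)) (ENNReal.ofReal s) volume ≤ N * w r) :
    Measurable (fun x => ∫⁻ r in Ioo 0 t, ‖kernelConv κ (t - r) (V r) x‖ₑ) ∧
    eLpNorm (fun x => ∫⁻ r in Ioo 0 t, ‖kernelConv κ (t - r) (V r) x‖ₑ) (ENNReal.ofReal s) volume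
      ≤ N * ∫⁻ r in Ioo 0 t, w r := by
  classical
  -- Continuity is known only on the open strip; extension by zero gives a globally measurable
  -- integrand.
  set F : ℝ × KSB.Rd d → ℝ≥0∞ := (Ioo 0 t ×ˢ univ).indicator
    (fun a => ‖kernelConv κ (t - a.1) (V a.1) a.2‖ₑ) with hF
  have hFm : Measurable F := by
    have h := (hκ.continuousOn_kernelConv hC hR hσ htR hV).enorm
    have hms : MeasurableSet (Ioo 0 t ×ˢ (univ : Set (KSB.Rd d))) :=
      measurableSet_Ioo.prod MeasurableSet.univ
    rw [hF, ← piecewise_eq_indicator]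
    exact h.measurable_piecewise continuousOn_const hms
  have hFe : ∀ r ∈ Ioo 0 t, ∀ x, F (r, x) = ‖kernelConv κ (t - r) (V r) x‖ₑ := fun r hr x => by
    rw [hF, indicator_of_mem (show (r, x) ∈ Ioo 0 t ×ˢ univ from ⟨hr, trivial⟩)]
  have e : (fun x => ∫⁻ r in Ioo 0 t, ‖kernelConv κ (t - r) (V r) x‖ₑ)
      = fun x => ∫⁻ r in Ioo 0 t, F (r, x) := by
    funext x
    exact setLIntegral_congr_fun measurableSet_Ioo fun r hr => (hFe r hr x).symm
  rw [e]
  refine ⟨(hFm.comp measurable_swap).lintegral_prod_right', ?_⟩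
  refine eLpNorm_lintegral_le (f := fun r x => F (r, x)) hFm hw
    (ae_restrict_of_forall_mem measurableSet_Ioo hw0) hwt hs
    (ae_restrict_of_forall_mem measurableSet_Ioo fun r hr => ?_)
  have : (fun x => F (r, x)) = fun x => ‖kernelConv κ (t - r) (V r) x‖ₑ := by
    funext x; exact hFe r hr x
  rw [this, eLpNorm_enorm]
  exact hN r hr

/-- A finite L^s norm forces the time integral of the modulus to be finite for almost every x. This
allows two Duhamel integrals to be subtracted under the integral sign. -/
theorem ae_integrableOn_kernelConv (hκ : IsParabolicKernel d j R C κ) (hC : 0 ≤ C)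
    (hR : 0 < R) {σ : ℝ} (hσ : 1 ≤ σ) {t : ℝ} (htR : t ≤ R ^ 4) {V : ℝ → KSB.Rd d → ℝ}
    (hV : IsLpCurve d σ t V)
    {s : ℝ} (hs : 1 ≤ s) {w : ℝ → ℝ≥0∞} (hw : Measurable w) (hw0 : ∀ r ∈ Ioo 0 t, w r ≠ 0)
    (hwt : ∀ r, w r ≠ ∞) {N : ℝ≥0∞} (hNt : N ≠ ∞) (hwi : ∫⁻ r in Ioo 0 t, w r ≠ ∞)
    (hN : ∀ r ∈ Ioo 0 t,
      eLpNorm (kernelConv κ (t - r) (V r)) (ENNReal.ofReal s) volume ≤ N * w r) :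
    ∀ᵐ x, IntegrableOn (fun r => kernelConv κ (t - r) (V r) x) (Ioo 0 t) := by
  obtain ⟨hm, hle⟩ := hκ.eLpNorm_lintegral_kernelConv_le hC hR hσ htR hV hs hw hw0 hwt hN
  have hs0 : 0 < s := by linarith
  have hfin := hle.trans_lt (ENNReal.mul_lt_top hNt.lt_top hwi.lt_top)
  rw [eLpNorm_ofReal_eq _ hs0, ENNReal.rpow_lt_top_iff_of_pos (inv_pos.2 hs0)] at hfin
  simp only [enorm_eq_self] at hfin
  filter_upwards [ae_lt_top (hm.pow_const s) hfin.ne] with x hx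
  rw [ENNReal.rpow_lt_top_iff_of_pos hs0] at hx
  refine ⟨ContinuousOn.aestronglyMeasurable ?_ measurableSet_Ioo, hx⟩
  exact (hκ.continuousOn_kernelConv hC hR hσ htR hV).comp
    (f := fun r : ℝ => (r, x)) (by fun_prop) (fun r hr => ⟨hr, trivial⟩)

end IsParabolicKernel

theorem IsLpCurve.sub {d : ℕ} {σ t : ℝ} (hσ : 1 ≤ σ) {V W : ℝ → KSB.Rd d → ℝ}
    (hV : IsLpCurve d σ t V) (hW : IsLpCurve d σ t W) :
    IsLpCurve d σ t (fun r => V r - W r) where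
  measurable r := (hV.measurable r).sub (hW.measurable r)
  memLp r := (hV.memLp r).sub (hW.memLp r)
  tendsto r₀ hr₀ := by
    have h := (hV.tendsto r₀ hr₀).add (hW.tendsto r₀ hr₀)
    rw [add_zero] at h
    refine tendsto_of_tendsto_of_tendsto_of_le_of_le tendsto_const_nhds h
      (fun _ => zero_le) fun r => ?_
    have e : V r - W r - (V r₀ - W r₀) = (V r - V r₀) - (W r - W r₀) := by abel
    simp only [e]
    exact eLpNorm_sub_le ((hV.measurable r).sub (hV.measurable r₀)).aestronglyMeasurable
      ((hW.measurable r).sub (hW.measurable r₀)).aestronglyMeasurable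
      (by rw [← ENNReal.ofReal_one]; exact ENNReal.ofReal_le_ofReal hσ)

/-! ### The singular weight and differences of Duhamel integrals. -/

/-- The singular exponential weight `(t-r)^{-α} e^{λ r}`. -/
noncomputable def singularWeight (α lam t r : ℝ) : ℝ≥0∞ :=
  ENNReal.ofReal ((t - r) ^ (-α) * Real.exp (lam * r))

theorem measurable_singularWeight (α lam t : ℝ) : Measurable (singularWeight α lam t) := by
  unfold singularWeight; fun_prop

/-- With s = t - r the integrand is e^{λt} s^{-α} e^{-λs}; enlarging the domain to s > 0 gives a
Gamma integral. -/
theorem setLIntegral_singularWeight_le {α lam : ℝ} (hα : α < 1) (hlam : 0 < lam) (t : ℝ) :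
    ∫⁻ r in Ioo 0 t, singularWeight α lam t r
      ≤ ENNReal.ofReal (Real.exp (lam * t) * ((1 / lam) ^ (1 - α) * Real.Gamma (1 - α))) := by
  have hval := Real.integral_rpow_mul_exp_neg_mul_Ioi (a := 1 - α) (sub_pos.2 hα) hlam
  have hpos : 0 < (1 / lam) ^ (1 - α) * Real.Gamma (1 - α) :=
    mul_pos (by positivity) (Real.Gamma_pos_of_pos (sub_pos.2 hα))
  -- A non-integrable function would have integral 0, contradicting the positive Gamma value.
  have hint : Integrable (fun s : ℝ => s ^ (1 - α - 1) * Real.exp (-(lam * s)))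
      (volume.restrict (Ioi 0)) := by
    by_contra h
    rw [integral_undef h] at hval
    exact hpos.ne hval
  set g : ℝ → ℝ≥0∞ := (Ioi 0).indicator fun s =>
    ENNReal.ofReal (s ^ (1 - α - 1) * Real.exp (-(lam * s))) with hg
  have hle : ∀ r ∈ Ioo 0 t,
      singularWeight α lam t r = ENNReal.ofReal (Real.exp (lam * t)) * g (t - r) := by
    intro r hr
    rw [hg, indicator_of_mem (show t - r ∈ Ioi 0 from sub_pos.2 hr.2), singularWeight,
      ← ENNReal.ofReal_mul (Real.exp_pos _).le]
    congr 1
    rw [show lam * r = lam * t + -(lam * (t - r)) by ring, Real.exp_add,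
      show 1 - α - 1 = -α by ring]
    ring
  rw [setLIntegral_congr_fun measurableSet_Ioo hle]
  calc _ ≤ ∫⁻ r, ENNReal.ofReal (Real.exp (lam * t)) * g (t - r) := setLIntegral_le_lintegral _ _
    _ = ENNReal.ofReal (Real.exp (lam * t)) * ∫⁻ s, g s := by
        rw [lintegral_const_mul' _ _ ENNReal.ofReal_ne_top, lintegral_sub_left_eq_self g t]
    _ = _ := by
        rw [hg, lintegral_indicator measurableSet_Ioi,
          ← ofReal_integral_eq_lintegral_ofReal hint
            (ae_restrict_of_forall_mem measurableSet_Ioi fun s hs => ?_), hval,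
          ← ENNReal.ofReal_mul (Real.exp_pos _).le]
        have : (0 : ℝ) < s := hs
        positivity

theorem exists_pos_mul_rpow_le_half {α B : ℝ} (hα : α < 1) (hB : 0 ≤ B) :
    ∃ lam : ℝ, 0 < lam ∧ B * ((1 / lam) ^ (1 - α) * Real.Gamma (1 - α)) ≤ 1 / 2 := by
  have hG := Real.Gamma_pos_of_pos (sub_pos.2 hα)
  have h1 : 1 - α ≠ 0 := (sub_pos.2 hα).ne'
  -- With λ = η^{1/(1-α)} the factor (1/λ)^{1-α} equals 1/η; the + 1 keeps η positive when B = 0.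
  set η := 2 * (B * Real.Gamma (1 - α) + 1) with hη
  have hη0 : 0 < η := by positivity
  refine ⟨η ^ (1 - α)⁻¹, by positivity, ?_⟩
  rw [Real.div_rpow zero_le_one (by positivity), Real.rpow_inv_rpow hη0.le h1, Real.one_rpow]
  have : B * (1 / η * Real.Gamma (1 - α)) = B * Real.Gamma (1 - α) / η := by ring
  rw [this, div_le_iff₀ hη0, hη]
  nlinarith

namespace IsParabolicKernel

variable {d j : ℕ} {R C : ℝ} {κ : ℝ → KSB.Rd d → ℝ}

/-- The smoothing estimate is a hypothesis, so the linear and the quadratic terms share one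
argument. The measurable majorant G stands in for the signed difference in later triangle
inequalities. Only the finiteness of N₁ and N₂ matters, for splitting the integrals. -/
theorem exists_bound_duhamel_sub (hκ : IsParabolicKernel d j R C κ) (hC : 0 ≤ C) (hR : 0 < R)
    {σ s α lam B : ℝ} (hσ : 1 ≤ σ) (hs : 1 ≤ s) (hα : α < 1) (hlam : 0 < lam) {t : ℝ}
    (htR : t ≤ R ^ 4)
    (hB : ∀ u, 0 < u → u ≤ R ^ 4 → ∀ v : KSB.Rd d → ℝ, Measurable v →
      eLpNorm (kernelConv κ u v) (ENNReal.ofReal s) volume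
        ≤ ENNReal.ofReal (B * u ^ (-α)) * eLpNorm v (ENNReal.ofReal σ) volume)
    {V W : ℝ → KSB.Rd d → ℝ} (hV : IsLpCurve d σ t V) (hW : IsLpCurve d σ t W)
    {N₁ N₂ N : ℝ≥0∞} (hN₁ : N₁ ≠ ∞) (hN₂ : N₂ ≠ ∞)
    (hVN : ∀ r ∈ Ioo 0 t, eLpNorm (V r) (ENNReal.ofReal σ) volume ≤ N₁)
    (hWN : ∀ r ∈ Ioo 0 t, eLpNorm (W r) (ENNReal.ofReal σ) volume ≤ N₂)
    (hVW : ∀ r ∈ Ioo 0 t, eLpNorm (V r - W r) (ENNReal.ofReal σ) volume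
      ≤ N * ENNReal.ofReal (Real.exp (lam * r))) :
    ∃ G : KSB.Rd d → ℝ≥0∞, Measurable G ∧
      (∀ᵐ x, ‖(∫ r in Ioo 0 t, kernelConv κ (t - r) (V r) x)
        - ∫ r in Ioo 0 t, kernelConv κ (t - r) (W r) x‖ₑ ≤ G x) ∧
      eLpNorm G (ENNReal.ofReal s) volume ≤ ENNReal.ofReal B * N *
        ENNReal.ofReal (Real.exp (lam * t) * ((1 / lam) ^ (1 - α) * Real.Gamma (1 - α))) := by
  have hw := measurable_singularWeight α lam t
  have hw0 : ∀ r ∈ Ioo 0 t, singularWeight α lam t r ≠ 0 := fun r hr => by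
    have := sub_pos.2 hr.2
    rw [singularWeight, ne_eq, ENNReal.ofReal_eq_zero, not_le]
    positivity
  have hwt : ∀ r, singularWeight α lam t r ≠ ∞ := fun r => ENNReal.ofReal_ne_top
  have hwI := setLIntegral_singularWeight_le hα hlam t
  have hwi := (hwI.trans_lt ENNReal.ofReal_lt_top).ne
  have hmul : ∀ r ∈ Ioo 0 t, ENNReal.ofReal (B * (t - r) ^ (-α)) *
      ENNReal.ofReal (Real.exp (lam * r)) = ENNReal.ofReal B * singularWeight α lam t r := by
    intro r hr
    have := sub_pos.2 hr.2
    rw [singularWeight, ← ENNReal.ofReal_mul' (by positivity), ← ENNReal.ofReal_mul'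
      (by positivity), mul_assoc]
  have key : ∀ {v : ℝ → KSB.Rd d → ℝ} {K : ℝ≥0∞}, (∀ r, Measurable (v r)) →
      (∀ r ∈ Ioo 0 t, eLpNorm (v r) (ENNReal.ofReal σ) volume
        ≤ K * ENNReal.ofReal (Real.exp (lam * r))) →
      ∀ r ∈ Ioo 0 t, eLpNorm (kernelConv κ (t - r) (v r)) (ENNReal.ofReal s) volume
        ≤ ENNReal.ofReal B * K * singularWeight α lam t r := by
    intro v K hv hK r hr
    calc _ ≤ ENNReal.ofReal (B * (t - r) ^ (-α)) * (K * ENNReal.ofReal (Real.exp (lam * r))) :=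
          (hB _ (sub_pos.2 hr.2) (by linarith [hr.1]) _ (hv r)).trans
            (mul_le_mul' le_rfl (hK r hr))
      _ = K * (ENNReal.ofReal (B * (t - r) ^ (-α)) * ENNReal.ofReal (Real.exp (lam * r))) := by
          ring
      _ = _ := by rw [hmul r hr]; ring
  have hexp : ∀ r ∈ Ioo 0 t, ∀ K : ℝ≥0∞, K ≤ K * ENNReal.ofReal (Real.exp (lam * r)) := by
    intro r hr K
    refine le_mul_of_one_le_right' ?_
    rw [← ENNReal.ofReal_one]
    exact ENNReal.ofReal_le_ofReal (Real.one_le_exp (by have := hr.1; positivity))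
  obtain ⟨hGm, hGle⟩ := hκ.eLpNorm_lintegral_kernelConv_le hC hR hσ htR (hV.sub hσ hW) hs hw hw0
    hwt (key (hV.sub hσ hW).measurable hVW)
  have hVi := hκ.ae_integrableOn_kernelConv hC hR hσ htR hV hs hw hw0 hwt
    (ENNReal.mul_ne_top ENNReal.ofReal_ne_top hN₁) hwi
    (key hV.measurable fun r hr => (hVN r hr).trans (hexp r hr _))
  have hWi := hκ.ae_integrableOn_kernelConv hC hR hσ htR hW hs hw hw0 hwt
    (ENNReal.mul_ne_top ENNReal.ofReal_ne_top hN₂) hwi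
    (key hW.measurable fun r hr => (hWN r hr).trans (hexp r hr _))
  refine ⟨_, hGm, ?_, hGle.trans (mul_le_mul' le_rfl hwI)⟩
  filter_upwards [hVi, hWi] with x hx1 hx2
  rw [← integral_sub hx1 hx2]
  refine (enorm_integral_le_lintegral_enorm _).trans (le_of_eq ?_)
  refine setLIntegral_congr_fun measurableSet_Ioo fun r hr => ?_
  simp only [hκ.kernelConv_sub (sub_pos.2 hr.2) (by linarith [hr.1]) hR hσ (hV.measurable r)
    (hW.measurable r) (hV.memLp r) (hW.memLp r) x]

/-- Smoothing estimate of a kernel of order zero on `L^σ`. -/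
theorem exists_smoothing_zero (hκ : IsParabolicKernel d 0 R C κ) (hC : 0 ≤ C) (hR : 0 < R)
    {σ α : ℝ} (hσ : 1 ≤ σ) (hα : 0 ≤ α) :
    ∃ B : ℝ, 0 ≤ B ∧ ∀ u, 0 < u → u ≤ R ^ 4 → ∀ v : KSB.Rd d → ℝ, Measurable v →
      eLpNorm (kernelConv κ u v) (ENNReal.ofReal σ) volume
        ≤ ENNReal.ofReal (B * u ^ (-α)) * eLpNorm v (ENNReal.ofReal σ) volume := by
  have hm := decayMass_nonneg d
  refine ⟨C * decayMass d * (R ^ 4) ^ α, by positivity, fun u hu huR v hv => ?_⟩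
  obtain ⟨c, hc, rfl⟩ := exists_pow_four hu
  refine (hκ.eLpNorm_kernelConv_le hc (le_of_pow_le_pow_left₀ four_ne_zero hR.le huR) hσ
    hv).trans (mul_le_mul' (ENNReal.ofReal_le_ofReal ?_) le_rfl)
  rw [pow_zero, inv_one, mul_assoc (C * decayMass d)]
  refine mul_le_mul_of_nonneg_left ?_ (by positivity)
  rw [Real.rpow_neg hu.le, ← div_eq_mul_inv, one_le_div (by positivity)]
  gcongr

/-- Smoothing estimate `L^p → L^{2p}` of a kernel of order one. -/
theorem exists_smoothing_one (hκ : IsParabolicKernel d 1 R C κ) (hC : 0 ≤ C) (hR : 0 < R)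
    {p : ℝ} (hp : 1 ≤ p) :
    ∃ B : ℝ, 0 ≤ B ∧ ∀ u, 0 < u → u ≤ R ^ 4 → ∀ v : KSB.Rd d → ℝ, Measurable v →
      eLpNorm (kernelConv κ u v) (ENNReal.ofReal (2 * p)) volume
        ≤ ENNReal.ofReal (B * u ^ (-((1 + d / (2 * p)) / 4))) *
          eLpNorm v (ENNReal.ofReal p) volume := by
  have hm := decayMass_nonneg d
  refine ⟨C * decayMass d ^ (1 - (2 * p)⁻¹), by positivity, fun u hu huR v hv => ?_⟩
  obtain ⟨c, hc, rfl⟩ := exists_pow_four hu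
  refine (hκ.eLpNorm_two_mul_kernelConv_le hc (le_of_pow_le_pow_left₀ four_ne_zero hR.le huR) hp
    hv).trans (le_of_eq ?_)
  rw [← Real.rpow_natCast, ← Real.rpow_mul hc.le]
  congr 4
  push_cast
  ring

end IsParabolicKernel

/-! ### The quadratic nonlinearity and curves of L^{2p} classes. -/

theorem eLpNorm_mul_le_two_mul {d : ℕ} {p : ℝ} (hp : 1 ≤ p) {f g : KSB.Rd d → ℝ}
    (hf : Measurable f) (hg : Measurable g) :
    eLpNorm (f * g) (ENNReal.ofReal p) volume
      ≤ eLpNorm f (ENNReal.ofReal (2 * p)) volume * eLpNorm g (ENNReal.ofReal (2 * p)) volume := by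
  have hp0 : 0 < p := by linarith
  have : ENNReal.HolderTriple (ENNReal.ofReal (2 * p)) (ENNReal.ofReal (2 * p))
      (ENNReal.ofReal p) := ⟨by
    rw [← ENNReal.ofReal_inv_of_pos (by positivity), ← ENNReal.ofReal_inv_of_pos hp0,
      ← ENNReal.ofReal_add (by positivity) (by positivity)]
    congr 1
    field_simp
    norm_num⟩
  have h := eLpNorm_smul_le_mul_eLpNorm (p := ENNReal.ofReal (2 * p)) (q := ENNReal.ofReal (2 * p))
    (r := ENNReal.ofReal p) (μ := volume) (f := g) (φ := f) hg.aestronglyMeasurable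
    hf.aestronglyMeasurable
  rwa [smul_eq_mul] at h

/-- Continuity comes from V² - V₀² = (V - V₀)((V - V₀) + 2V₀) and Hölder. -/
theorem IsLpCurve.sq {d : ℕ} {p t : ℝ} (hp : 1 ≤ p) {V : ℝ → KSB.Rd d → ℝ}
    (hV : IsLpCurve d (2 * p) t V) : IsLpCurve d p t (fun r y => V r y ^ 2) where
  measurable r := (hV.measurable r).pow_const 2
  memLp r := by
    refine ⟨((hV.measurable r).pow_const 2).aestronglyMeasurable, ?_⟩
    have h := eLpNorm_mul_le_two_mul hp (hV.measurable r) (hV.measurable r)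
    have e : (fun y => V r y ^ 2) = V r * V r := by funext y; simp [_root_.sq]
    rw [e]
    exact h.trans_lt (ENNReal.mul_lt_top (hV.memLp r).2 (hV.memLp r).2)
  tendsto r₀ hr₀ := by
    have h := hV.tendsto r₀ hr₀
    set K := eLpNorm (V r₀ + V r₀) (ENNReal.ofReal (2 * p)) volume with hK
    have hKt : K ≠ ∞ := ((hV.memLp r₀).add (hV.memLp r₀)).2.ne
    have hlim := ENNReal.Tendsto.mul h (Or.inr (by simpa using hKt)) (h.add_const K)
      (Or.inr ENNReal.zero_ne_top)
    rw [zero_mul] at hlim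
    refine tendsto_of_tendsto_of_tendsto_of_le_of_le tendsto_const_nhds hlim
      (fun _ => zero_le) fun r => ?_
    have e : ((fun y => V r y ^ 2) - fun y => V r₀ y ^ 2)
        = (V r - V r₀) * ((V r - V r₀) + (V r₀ + V r₀)) := by
      funext y; simp only [Pi.sub_apply, Pi.mul_apply, Pi.add_apply]; ring
    have hm := (hV.measurable r).sub (hV.measurable r₀)
    have hm₀ := (hV.measurable r₀).add (hV.measurable r₀)
    simp only [e]
    refine (eLpNorm_mul_le_two_mul hp hm (hm.add hm₀)).trans ?_
    gcongr
    exact eLpNorm_add_le hm.aestronglyMeasurable hm₀.aestronglyMeasurable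
      (by rw [← ENNReal.ofReal_one]; exact ENNReal.ofReal_le_ofReal (by linarith))

theorem isLpCurve_of_continuousOn {d : ℕ} {p t τ : ℝ} [Fact (1 ≤ p)] {U : ℝ → KSB.L2p d p}
    (hU : ContinuousOn U (Icc 0 τ)) (ht : t ≤ τ) : IsLpCurve d (2 * p) t (fun r => U r) where
  measurable r := (Lp.stronglyMeasurable (U r)).measurable
  memLp r := Lp.memLp (U r)
  tendsto r₀ hr₀ := by
    have h : ContinuousAt U r₀ :=
      hU.continuousAt (Icc_mem_nhds hr₀.1 (hr₀.2.trans_le ht))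
    have := tendsto_iff_edist_tendsto_0.1 h
    simpa only [Lp.edist_def] using this

theorem eLpNorm_coe_le_ofReal {d : ℕ} {p : ℝ} [Fact (1 ≤ p)] {f : KSB.L2p d p} {M : ℝ}
    (h : ‖f‖ ≤ M) : eLpNorm f (ENNReal.ofReal (2 * p)) volume ≤ ENNReal.ofReal M := by
  rw [← Lp.enorm_def, ← ofReal_norm]
  exact ENNReal.ofReal_le_ofReal h

theorem integral_integral_kernel_eq {d : ℕ} {k : ℝ → KSB.Rd d → KSB.Rd d → ℝ}
    {κ : ℝ → KSB.Rd d → ℝ} (h : ∀ s, 0 < s → ∀ x y, k s x y = κ s (x - y)) {t : ℝ} (ht : 0 ≤ t)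
    (v : ℝ → KSB.Rd d → ℝ) (x : KSB.Rd d) :
    ∫ r in (0 : ℝ)..t, ∫ y, k (t - r) x y * v r y
      = ∫ r in Ioo 0 t, kernelConv κ (t - r) (v r) x := by
  rw [intervalIntegral.integral_of_le ht, integral_Ioc_eq_integral_Ioo]
  refine setIntegral_congr_fun measurableSet_Ioo fun r hr => ?_
  simp only [kernelConv, h _ (sub_pos.2 hr.2)]

/-! ### The weighted difference estimate and the absorption argument. -/

/-- The a priori estimate for the difference of two solutions, with an exponential weight. -/
theorem exists_lks_difference_bound (T : ℝ) (hT : 0 < T) (p : ℝ) [hp : Fact (1 ≤ p)] (d : ℕ)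
    {α : ℝ} (hαd : α = (1 + d / (2 * p)) / 4) (hα : α < 1) :
    ∃ A B₀ B₁ : ℝ, 0 ≤ A ∧ 0 ≤ B₀ ∧ 0 ≤ B₁ ∧ ∀ τ, τ ≤ T →
      ∀ (u₁ u₂ : KSB.L2p d p) (U₁ U₂ : ℝ → KSB.L2p d p),
        KSB.IsLKSSolution d p τ u₁ U₁ → KSB.IsLKSSolution d p τ u₂ U₂ →
        ∀ M lam n : ℝ, 0 ≤ M → 0 < lam → 0 ≤ n →
        (∀ r ∈ Icc 0 τ, ‖U₁ r‖ ≤ M) → (∀ r ∈ Icc 0 τ, ‖U₂ r‖ ≤ M) →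
        (∀ r ∈ Icc 0 τ, ‖U₁ r - U₂ r‖ ≤ n * Real.exp (lam * r)) →
        ∀ t ∈ Ioc 0 τ, ‖U₁ t - U₂ t‖ ≤ A * ‖u₁ - u₂‖ + n * (B₀ + B₁ * M) *
          (Real.exp (lam * t) * ((1 / lam) ^ (1 - α) * Real.Gamma (1 - α))) := by
  have hp1 : 1 ≤ p := hp.out
  have h2p : 1 ≤ 2 * p := by linarith
  have hα0 : 0 ≤ α := by rw [hαd]; positivity
  -- The slack R⁴ = T + 1 makes c < R strict for every c⁴ ≤ T, as continuity of the convolution at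
  -- time c⁴ requires.
  obtain ⟨R, hR, hRT⟩ := exists_pow_four (show 0 < T + 1 by linarith)
  obtain ⟨C₀, hC₀, κ₀, hκ₀, hk₀⟩ := exists_isParabolicKernel_lksKernel d R
  choose C₁ hC₁ κ₁ hκ₁ hk₁ using exists_isParabolicKernel_lksKernelDeriv d R
  -- The data term is not integrated in time and needs no singularity; the linear Duhamel term next
  -- takes the same α as the derivative terms, so that one weight serves all of them.
  obtain ⟨A, hA, hAb⟩ := hκ₀.exists_smoothing_zero hC₀ hR h2p (α := 0) le_rfl
  obtain ⟨B₀, hB₀, hB₀b⟩ := hκ₀.exists_smoothing_zero hC₀ hR h2p hα0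
  choose B hB hBb using fun ℓ => (hκ₁ ℓ).exists_smoothing_one (hC₁ ℓ) hR hp1
  simp only [← hαd] at hBb
  -- The factor 2 comes from |U₁ + U₂|_{2p} ≤ 2M; the coefficients 1/2 in the equation are simply
  -- bounded by 1.
  refine ⟨A, B₀, ∑ ℓ, B ℓ * 2, hA, hB₀, Finset.sum_nonneg fun ℓ _ => by have := hB ℓ; positivity,
    ?_⟩
  intro τ hτT u₁ u₂ U₁ U₂ hU₁ hU₂ M lam n hM hlam hn hM₁ hM₂ hW t ht
  have htR : t ≤ R ^ 4 := by linarith [ht.2]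
  have hV₁ := isLpCurve_of_continuousOn hU₁.continuousOn ht.2
  have hV₂ := isLpCurve_of_continuousOn hU₂.continuousOn ht.2
  have hIcc : ∀ r ∈ Ioo 0 t, r ∈ Icc 0 τ := fun r hr => ⟨hr.1.le, hr.2.le.trans ht.2⟩
  set J := Real.exp (lam * t) * ((1 / lam) ^ (1 - α) * Real.Gamma (1 - α)) with hJ
  have hJ0 : 0 ≤ J := by
    have := Real.Gamma_pos_of_pos (sub_pos.2 hα)
    positivity
  have hdiff : ∀ r ∈ Ioo 0 t, eLpNorm (⇑(U₁ r) - ⇑(U₂ r)) (ENNReal.ofReal (2 * p)) volume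
      ≤ ENNReal.ofReal n * ENNReal.ofReal (Real.exp (lam * r)) := by
    intro r hr
    rw [← eLpNorm_congr_ae (Lp.coeFn_sub (U₁ r) (U₂ r)), ← ENNReal.ofReal_mul hn]
    exact eLpNorm_coe_le_ofReal (hW r (hIcc r hr))
  have hsq : ∀ {U : ℝ → KSB.L2p d p}, IsLpCurve d (2 * p) t (fun r => U r) →
      (∀ r ∈ Icc 0 τ, ‖U r‖ ≤ M) →
      ∀ r ∈ Ioo 0 t, eLpNorm (fun y => U r y ^ 2) (ENNReal.ofReal p) volume
        ≤ ENNReal.ofReal M * ENNReal.ofReal M := by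
    intro U hU hUM r hr
    have e : (fun y => U r y ^ 2) = ⇑(U r) * ⇑(U r) := by
      funext y; simp [_root_.sq]
    rw [e]
    have h := eLpNorm_coe_le_ofReal (hUM r (hIcc r hr))
    exact (eLpNorm_mul_le_two_mul hp1 (hU.measurable r) (hU.measurable r)).trans
      (mul_le_mul' h h)
  have hsqdiff : ∀ r ∈ Ioo 0 t, eLpNorm ((fun y => U₁ r y ^ 2) - fun y => U₂ r y ^ 2)
      (ENNReal.ofReal p) volume
      ≤ ENNReal.ofReal n * ENNReal.ofReal (2 * M) * ENNReal.ofReal (Real.exp (lam * r)) := by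
    intro r hr
    have e : ((fun y => U₁ r y ^ 2) - fun y => U₂ r y ^ 2)
        = (⇑(U₁ r) - ⇑(U₂ r)) * (⇑(U₁ r) + ⇑(U₂ r)) := by
      funext y; simp only [Pi.sub_apply, Pi.mul_apply, Pi.add_apply]; ring
    rw [e]
    have hadd : eLpNorm (⇑(U₁ r) + ⇑(U₂ r)) (ENNReal.ofReal (2 * p)) volume
        ≤ ENNReal.ofReal (2 * M) := by
      rw [← eLpNorm_congr_ae (Lp.coeFn_add (U₁ r) (U₂ r))]
      refine eLpNorm_coe_le_ofReal ((norm_add_le _ _).trans ?_)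
      linarith [hM₁ r (hIcc r hr), hM₂ r (hIcc r hr)]
    refine (eLpNorm_mul_le_two_mul hp1 ((hV₁.measurable r).sub (hV₂.measurable r))
      ((hV₁.measurable r).add (hV₂.measurable r))).trans
      ((mul_le_mul' (hdiff r hr) hadd).trans (le_of_eq ?_))
    ring
  obtain ⟨G₀, hG₀m, hG₀, hG₀n⟩ := hκ₀.exists_bound_duhamel_sub hC₀ hR h2p h2p hα hlam htR hB₀b
    hV₁ hV₂ ENNReal.ofReal_ne_top ENNReal.ofReal_ne_top
    (fun r hr => eLpNorm_coe_le_ofReal (hM₁ r (hIcc r hr)))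
    (fun r hr => eLpNorm_coe_le_ofReal (hM₂ r (hIcc r hr))) hdiff
  have hMM : ENNReal.ofReal M * ENNReal.ofReal M ≠ ∞ :=
    ENNReal.mul_ne_top ENNReal.ofReal_ne_top ENNReal.ofReal_ne_top
  choose G hGm hG hGn using fun ℓ => (hκ₁ ℓ).exists_bound_duhamel_sub (hC₁ ℓ) hR hp1 h2p hα hlam
    htR (hBb ℓ) (hV₁.sq hp1) (hV₂.sq hp1) hMM hMM (hsq hV₁ hM₁) (hsq hV₂ hM₂) hsqdiff
  have hu₁ := (Lp.stronglyMeasurable u₁).measurable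
  have hu₂ := (Lp.stronglyMeasurable u₂).measurable
  set H : KSB.Rd d → ℝ := kernelConv κ₀ t (⇑u₁ - ⇑u₂) with hH
  have hHm : Measurable H := by
    obtain ⟨c, hc, hct⟩ := exists_pow_four ht.1
    have hcR : c < R := lt_of_pow_lt_pow_left₀ 4 hR.le (by rw [hct, hRT]; linarith [ht.2])
    refine Continuous.measurable (continuous_iff_continuousAt.2 fun x => ?_)
    have := hκ₀.continuousAt_kernelConv hC₀ h2p (hu₁.sub hu₂) ((Lp.memLp u₁).sub (Lp.memLp u₂))
      hc hcR x
    rw [hct] at this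
    exact ContinuousAt.comp (f := fun x : KSB.Rd d => (t, x))
      (g := fun a : ℝ × KSB.Rd d => kernelConv κ₀ a.1 (⇑u₁ - ⇑u₂) a.2)
      this (by fun_prop)
  have hHn : eLpNorm H (ENNReal.ofReal (2 * p)) volume ≤ ENNReal.ofReal (A * ‖u₁ - u₂‖) := by
    refine (hAb t ht.1 htR _ (hu₁.sub hu₂)).trans ?_
    rw [neg_zero, Real.rpow_zero, mul_one, ENNReal.ofReal_mul hA,
      ← eLpNorm_congr_ae (Lp.coeFn_sub u₁ u₂)]
    gcongr
    exact eLpNorm_coe_le_ofReal le_rfl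
  have hpt : ∀ᵐ x, ‖(U₁ t - U₂ t : KSB.L2p d p) x‖ₑ ≤ ‖H x‖ₑ + (G₀ x + ∑ ℓ, G ℓ x) := by
    have htI : t ∈ Icc 0 τ := ⟨ht.1.le, ht.2⟩
    filter_upwards [Lp.coeFn_sub (U₁ t) (U₂ t), hU₁.mild t htI, hU₂.mild t htI, hG₀,
      ae_all_iff.2 hG] with x hx h1 h2 hx0 hxG
    rw [hx, Pi.sub_apply, h1, h2]
    simp only [KSB.lksOpInit, if_neg ht.1.ne', KSB.lksOp, KSB.lksOpDeriv]
    simp only [integral_integral_kernel_eq hk₀ ht.1.le,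
      fun ℓ => integral_integral_kernel_eq (hk₁ ℓ) ht.1.le]
    have e0 : (∫ y, KSB.lksKernel d t x y * u₁ y) - ∫ y, KSB.lksKernel d t x y * u₂ y = H x := by
      simp only [hk₀ t ht.1]
      exact (hκ₀.kernelConv_sub ht.1 htR hR h2p hu₁ hu₂ (Lp.memLp u₁) (Lp.memLp u₂) x).symm
    have half : ∀ a : ℝ, ‖1 / 2 * a‖ₑ ≤ ‖a‖ₑ := by
      intro a
      rw [enorm_mul]
      refine mul_le_of_le_one_left' ?_
      rw [Real.enorm_of_nonneg (by norm_num), ENNReal.ofReal_le_one]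
      norm_num
    have e1 : ∀ a₁ a₂ b₁ b₂ : ℝ, ∀ c₁ c₂ : Fin d → ℝ,
        (a₁ + 1 / 2 * b₁ + 1 / 2 * ∑ ℓ, c₁ ℓ) - (a₂ + 1 / 2 * b₂ + 1 / 2 * ∑ ℓ, c₂ ℓ)
        = (a₁ - a₂) + (1 / 2 * (b₁ - b₂) + 1 / 2 * ∑ ℓ, (c₁ ℓ - c₂ ℓ)) := by
      intros; rw [Finset.sum_sub_distrib]; ring
    rw [e1, e0]
    refine (enorm_add_le _ _).trans (add_le_add le_rfl ((enorm_add_le _ _).trans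
      (add_le_add ((half _).trans hx0) ((half _).trans ?_))))
    exact (enorm_sum_le _ _).trans (Finset.sum_le_sum fun ℓ _ => hxG ℓ)
  have h2pE : (1 : ℝ≥0∞) ≤ ENNReal.ofReal (2 * p) := by
    rw [← ENNReal.ofReal_one]; exact ENNReal.ofReal_le_ofReal h2p
  have hsumm : AEStronglyMeasurable (∑ ℓ, G ℓ) volume :=
    Finset.aestronglyMeasurable_sum _ fun ℓ _ => (hGm ℓ).aestronglyMeasurable
  have hfin : eLpNorm (U₁ t - U₂ t : KSB.L2p d p) (ENNReal.ofReal (2 * p)) volume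
      ≤ ENNReal.ofReal (A * ‖u₁ - u₂‖ + n * (B₀ + (∑ ℓ, B ℓ * 2) * M) * J) := by
    calc _ ≤ eLpNorm ((fun x => ‖H x‖ₑ) + (G₀ + ∑ ℓ, G ℓ)) (ENNReal.ofReal (2 * p)) volume := by
          refine eLpNorm_mono_enorm_ae ?_
          filter_upwards [hpt] with x hx
          simpa using hx
      _ ≤ eLpNorm H (ENNReal.ofReal (2 * p)) volume
          + (eLpNorm G₀ (ENNReal.ofReal (2 * p)) volume
            + ∑ ℓ, eLpNorm (G ℓ) (ENNReal.ofReal (2 * p)) volume) := by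
          refine (eLpNorm_add_le hHm.enorm.aestronglyMeasurable
            (hG₀m.aestronglyMeasurable.add hsumm) h2pE).trans ?_
          rw [eLpNorm_enorm]
          gcongr
          refine (eLpNorm_add_le hG₀m.aestronglyMeasurable hsumm h2pE).trans ?_
          gcongr
          exact eLpNorm_sum_le (fun ℓ _ => (hGm ℓ).aestronglyMeasurable) h2pE
      _ ≤ ENNReal.ofReal (A * ‖u₁ - u₂‖) + (ENNReal.ofReal (B₀ * n * J)
            + ∑ ℓ, ENNReal.ofReal (B ℓ * (n * (2 * M)) * J)) := by
          refine add_le_add hHn (add_le_add (hG₀n.trans (le_of_eq ?_))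
            (Finset.sum_le_sum fun ℓ _ => (hGn ℓ).trans (le_of_eq ?_)))
          · rw [← ENNReal.ofReal_mul hB₀, ← ENNReal.ofReal_mul (by positivity)]
          · have := hB ℓ
            rw [← ENNReal.ofReal_mul hn, ← ENNReal.ofReal_mul this,
              ← ENNReal.ofReal_mul (by positivity)]
      _ = _ := by
          have hBn : ∀ ℓ, 0 ≤ B ℓ * (n * (2 * M)) * J := fun ℓ => by have := hB ℓ; positivity
          rw [← ENNReal.ofReal_sum_of_nonneg fun ℓ _ => hBn ℓ,
            ← ENNReal.ofReal_add (by positivity) (Finset.sum_nonneg fun ℓ _ => hBn ℓ),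
            ← ENNReal.ofReal_add (by positivity)
              (add_nonneg (by positivity) (Finset.sum_nonneg fun ℓ _ => hBn ℓ))]
          congr 2
          have : ∑ ℓ, B ℓ * (n * (2 * M)) * J = (∑ ℓ, B ℓ * 2) * (n * M * J) := by
            rw [Finset.sum_mul]
            exact Finset.sum_congr rfl fun ℓ _ => by ring
          rw [this]
          ring
  rw [← Lp.enorm_def, ← ofReal_norm] at hfin
  refine (ENNReal.ofReal_le_ofReal_iff ?_).1 hfin
  have : 0 ≤ ∑ ℓ, B ℓ * 2 := Finset.sum_nonneg fun ℓ _ => by have := hB ℓ; positivity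
  positivity

/-- Compactness supplies the boundedness without which the real supremum would be a default value.
-/
theorem norm_le_iSup_Icc {E : Type*} [NormedAddCommGroup E] {τ : ℝ} {U : ℝ → E}
    (hU : ContinuousOn U (Icc 0 τ)) {r : ℝ} (hr : r ∈ Icc 0 τ) :
    ‖U r‖ ≤ ⨆ r : Icc (0 : ℝ) τ, ‖U r‖ := by
  obtain ⟨K, hK⟩ := (isCompact_Icc.image_of_continuousOn hU.norm).bddAbove
  exact le_ciSup (f := fun r : Icc (0 : ℝ) τ => ‖U r‖)
    ⟨K, by rintro _ ⟨s, rfl⟩; exact hK ⟨s, s.2, rfl⟩⟩ ⟨r, hr⟩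

theorem mainTheorem6 (T : ℝ) (hT : 0 < T) (p : ℝ) [hp : Fact (1 ≤ p)]
    (d : ℕ) (hd : 1 ≤ d) (hdp : (d : ℝ) < 6 * p) :
    ∃ C : ℝ → ℝ, (∀ M, 0 < C M) ∧
      ∀ τ : ℝ, 0 < τ → τ ≤ T →
      ∀ (u₁ u₂ : KSB.L2p d p) (U₁ U₂ : ℝ → KSB.L2p d p),
        KSB.IsLKSSolution d p τ u₁ U₁ →
        KSB.IsLKSSolution d p τ u₂ U₂ →
        ∀ t ∈ Set.Icc 0 τ,
          ‖U₁ t - U₂ t‖ ≤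
            C (max (⨆ r : Set.Icc (0 : ℝ) τ, ‖U₁ r‖) (⨆ r : Set.Icc (0 : ℝ) τ, ‖U₂ r‖))
              * ‖u₁ - u₂‖ := by
  have hp1 : 1 ≤ p := hp.out
  have hα : ((1 + d / (2 * p)) / 4 : ℝ) < 1 := by
    have : (d : ℝ) / (2 * p) < 3 := by rw [div_lt_iff₀ (by positivity)]; linarith
    linarith
  obtain ⟨A, B₀, B₁, hA, hB₀, hB₁, H⟩ := exists_lks_difference_bound T hT p d rfl hα
  -- λ is chosen before τ and the solutions, so it depends on M, T, d, p only; |M| makes the choice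
  -- possible for every real M.
  choose lam hlam hlamB using fun M : ℝ =>
    exists_pos_mul_rpow_le_half hα (B := B₀ + B₁ * |M|) (by positivity)
  refine ⟨fun M => 2 * (A + 1) * Real.exp (lam M * T), fun M => by positivity, ?_⟩
  intro τ hτ hτT u₁ u₂ U₁ U₂ hU₁ hU₂ t ht
  set M := max (⨆ r : Icc (0 : ℝ) τ, ‖U₁ r‖) (⨆ r : Icc (0 : ℝ) τ, ‖U₂ r‖) with hMdef
  have hM₁ : ∀ r ∈ Icc 0 τ, ‖U₁ r‖ ≤ M := fun r hr =>
    (norm_le_iSup_Icc hU₁.continuousOn hr).trans (le_max_left _ _)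
  have hM₂ : ∀ r ∈ Icc 0 τ, ‖U₂ r‖ ≤ M := fun r hr =>
    (norm_le_iSup_Icc hU₂.continuousOn hr).trans (le_max_right _ _)
  have hM : 0 ≤ M := (norm_nonneg _).trans (hM₁ t ht)
  -- The weighted norm attains its maximum n, a finite number, which is what permits absorption.
  obtain ⟨r₀, hr₀, hmax⟩ := isCompact_Icc.exists_isMaxOn (nonempty_Icc.2 hτ.le)
    (f := fun r => Real.exp (-(lam M * r)) * ‖U₁ r - U₂ r‖)
    ((by fun_prop : Continuous fun r => Real.exp (-(lam M * r))).continuousOn.mul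
      (hU₁.continuousOn.sub hU₂.continuousOn).norm)
  set n := Real.exp (-(lam M * r₀)) * ‖U₁ r₀ - U₂ r₀‖ with hn
  have hn0 : 0 ≤ n := by positivity
  have hW : ∀ r ∈ Icc 0 τ, ‖U₁ r - U₂ r‖ ≤ n * Real.exp (lam M * r) := by
    intro r hr
    have h : Real.exp (-(lam M * r)) * ‖U₁ r - U₂ r‖ ≤ n := hmax hr
    rw [Real.exp_neg, inv_mul_le_iff₀ (Real.exp_pos _)] at h
    linarith
  have hn_le : n ≤ 2 * (A + 1) * ‖u₁ - u₂‖ := by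
    -- The difference estimate covers positive times only. At r₀ = 0 the Duhamel integrals vanish
    -- and the mild equation returns the initial data; the constant A + 1 ≥ 1 covers this case.
    rcases hr₀.1.eq_or_lt with h0 | h0
    · have hinit : U₁ r₀ - U₂ r₀ = u₁ - u₂ := by
        have hz : ∀ {u : KSB.L2p d p} {U : ℝ → KSB.L2p d p}, KSB.IsLKSSolution d p τ u U →
            U 0 = u := by
          intro u U hU
          refine Lp.ext ?_
          filter_upwards [hU.mild 0 ⟨le_rfl, hτ.le⟩] with x hx
          rw [hx]
          simp [KSB.lksOpInit, KSB.lksOp, KSB.lksOpDeriv]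
        rw [← h0, hz hU₁, hz hU₂]
      rw [hn, hinit, ← h0]
      simp only [mul_zero, neg_zero, Real.exp_zero, one_mul]
      nlinarith [norm_nonneg (u₁ - u₂), mul_nonneg hA (norm_nonneg (u₁ - u₂))]
    · have hb := H τ hτT u₁ u₂ U₁ U₂ hU₁ hU₂ M (lam M) n hM (hlam M) hn0 hM₁ hM₂ hW r₀ ⟨h0, hr₀.2⟩
      have hl := hlamB M
      rw [abs_of_nonneg hM] at hl
      have hexp1 : Real.exp (-(lam M * r₀)) ≤ 1 :=
        Real.exp_le_one_iff.2 (by have := hlam M; have := hr₀.1; simp; positivity)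
      have hexp2 : Real.exp (-(lam M * r₀)) * Real.exp (lam M * r₀) = 1 := by
        rw [← Real.exp_add]; simp
      set g := (1 / lam M) ^ (1 - (1 + d / (2 * p)) / 4 : ℝ) *
        Real.Gamma (1 - (1 + d / (2 * p)) / 4) with hg
      -- The estimate at the maximum point r₀, multiplied by e^{-λr₀}: the exponentials in the
      -- Duhamel part cancel, and the choice of λ leaves the factor 1/2.
      have h3 : n ≤ A * ‖u₁ - u₂‖ + n * (1 / 2) := by
        calc n ≤ Real.exp (-(lam M * r₀)) * (A * ‖u₁ - u₂‖
              + n * (B₀ + B₁ * M) * (Real.exp (lam M * r₀) * g)) := by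
              rw [hn]; gcongr
          _ = Real.exp (-(lam M * r₀)) * (A * ‖u₁ - u₂‖) + n * ((B₀ + B₁ * M) * g) *
              (Real.exp (-(lam M * r₀)) * Real.exp (lam M * r₀)) := by ring
          _ ≤ _ := by
              rw [hexp2, mul_one]
              refine add_le_add (mul_le_of_le_one_left (by positivity) hexp1) ?_
              gcongr
      nlinarith [norm_nonneg (u₁ - u₂)]
  calc ‖U₁ t - U₂ t‖ ≤ n * Real.exp (lam M * t) := hW t ht
    _ ≤ 2 * (A + 1) * ‖u₁ - u₂‖ * Real.exp (lam M * T) := by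
        have := (hlam M).le
        have := ht.2.trans hτT
        gcongr
    _ = _ := by ring
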